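/- Let $(K,\rho)$ be a nonempty compact metric space and let $\Gamma=\{\gamma_i:K\to K\}_{i=1}^d$ be a finite family of contractions with $K=\bigcup_{i=1}^d\gamma_i(K)$. Let $\Omega=\{1,\dots,d\}^{\mathbb N}$, let $\sigma$ be the left shift on $\Omega$, and let $F:\Omega\to K$, $F(i_0,i_1,\dots)=\lim_n\gamma_{i_0}\circ\cdots\circ\gamma_{i_n}(x)$ (for any $x\in K$), be the code map. Let $$G=\{(\omega,m-n,\tau)\in\Omega\times\mathbb Z\times\Omega:\ m,n\in\mathbb N,\ \sigma^m(\omega)=\sigma^n(\tau)\}$$ with its usual étale topology, generated by the sets $\{(\omega,m-n,\tau):\omega\in U,\tau\in V,\sigma^m(\omega)=\sigma^n(\tau)\}$, where $U,V\subseteq\Omega$ are open, $\sigma^m|_U$ and $\sigma^n|_V$ are homeomorphisms onto their images and $\sigma^m(U)=\sigma^n(V)$. The Cuntz algebra $\mathcal O_d$ is regarded as the groupoid C*-algebra $C^*(G)$, the completion of the convolution $*$-algebra $C_c(G)$ in the full C*-norm. Let $A=C(K)$, $\mathcal G=\bigcup_{i=1}^d\{(x,y)\in K\times K:x=\gamma_i(y)\}$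 and $E=C(\mathcal G)$, with the C*-correspondence structure over $A$ given by $(\phi(a)\xi b)(x,y)=a(x)\xi(x,y)b(y)$ and $\langle\xi,\eta\rangle(y)=\sum_{i=1}^d\overline{\xi(\gamma_i(y),y)}\,\eta(\gamma_i(y),y)$. Let $\mathcal K(E)$ be the closed linear span of the operators $\theta_{\xi,\eta}(\zeta)=\xi\langle\eta,\zeta\rangle$ and $J_E=\phi^{-1}(\mathcal K(E))$. Let $C(\Gamma)=\{y\in K:\gamma_i(y)=\gamma_j(y)\text{ for some }i\ne j\}$ be the set of branched values. Suppose that at least one of the following holds: * (finite branch condition) $C(\Gamma)$ is finite, and no point of $C(\Gamma)$ is an isolated point of $K$; * (open set condition) there is a dense open set $U\subseteq K$ with $\gamma_i(U)\subseteq U$ for all $i$ and $\gamma_i(U)\cap\gamma_j(U)=\emptyset$ for all $i\neq j$. Then the maps $\iota:A\to\mathcal O_d$ and $\psi:E\to\mathcal O_d$ given by the elements of $C_c(G)$ $$\iota(a)(\omega,k,\tau)=[k=0][\omega=\tau]\,a(F(\omega)),\qquad \psi(\xi)(\omega,k,\tau)=[k=1][\sigma(\omega)=\tau]\,\xi(F(\omega),F(\tau))$$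 form a Cuntz–Pimsner covariant representation of $(A,E)$ in $\mathcal O_d$. That is, $\iota$ is a $*$-homomorphism, $\psi$ is linear, and for all $a,b\in A$ and $\xi,\eta\in E$: 1. $\psi(\phi(a)\xi b)=\iota(a)\psi(\xi)\iota(b)$; 2. $\psi(\xi)^*\psi(\eta)=\iota(\langle\xi,\eta\rangle)$; 3. there is a (necessarily unique) bounded linear map $(\psi,\iota)^{(1)}:\mathcal K(E)\to\mathcal O_d$ with $(\psi,\iota)^{(1)}(\theta_{\xi,\eta})=\psi(\xi)\psi(\eta)^*$ for all $\xi,\eta\in E$, and it satisfies $(\psi,\iota)^{(1)}(\phi(c))=\iota(c)$ for every $c\in J_E$. -/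

import Mathlib

set_option linter.unusedSectionVars false

noncomputable section

namespace KW

open Topology Filter

/-- The space of one-sided infinite words over the alphabet `Fin d`, with the product topology. -/
abbrev Words (d : ℕ) : Type := ℕ → Fin d

/-- The left shift. -/
def shift {d : ℕ} (ω : Words d) : Words d := fun n => ω (n + 1)

theorem shift_iterate_apply {d : ℕ} (m : ℕ) (ω : Words d) (n : ℕ) :
    shift^[m] ω n = ω (n + m) := by
  induction m generalizing ω with
  | zero => rfl
  | succ m ih => rw [Function.iterate_succ_apply, ih]; simp only [shift]; congr 1

theorem continuous_shift {d : ℕ} : Continuous (shift (d := d)) :=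
  continuous_pi fun n => continuous_apply (n + 1)

/-- The word obtained by writing the `n` letters of `β` in front of `ω`. -/
def prepend {d n : ℕ} (β : Fin n → Fin d) (ω : Words d) : Words d :=
  fun j => if h : j < n then β ⟨j, h⟩ else ω (j - n)

theorem continuous_prepend {d n : ℕ} (β : Fin n → Fin d) : Continuous (prepend β) := by
  refine continuous_pi fun j => ?_
  unfold prepend
  by_cases h : j < n
  · simp only [h, dif_pos]; exact continuous_const
  · simp only [h, dif_neg, not_false_eq_true]; exact continuous_apply _

theorem shift_iterate_prepend {d n : ℕ} (β : Fin n → Fin d) (ω : Words d) :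
    shift^[n] (prepend β ω) = ω := by
  funext j
  rw [shift_iterate_apply]
  simp [prepend]

theorem prepend_restrict {d : ℕ} (n : ℕ) (τ : Words d) :
    prepend (fun j : Fin n => τ j) (shift^[n] τ) = τ := by
  funext j
  unfold prepend
  split_ifs with h
  · rfl
  · rw [shift_iterate_apply]; congr 1; omega

theorem eq_of_shift_iterate_eq {d m : ℕ} {ω τ : Words d} (h : shift^[m] ω = shift^[m] τ)
    (h' : ∀ j < m, ω j = τ j) : ω = τ := by
  rw [← prepend_restrict m ω, ← prepend_restrict m τ, h]
  congr 1
  funext j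
  exact h' j j.2

/-- The set of infinite words that agree with `ω` in the first `m` letters. -/
def cyl {d : ℕ} (m : ℕ) (ω : Words d) : Set (Words d) := {τ | ∀ j < m, τ j = ω j}

theorem isOpen_cyl {d : ℕ} (m : ℕ) (ω : Words d) : IsOpen (cyl m ω) := by
  have : cyl m ω = ⋂ j ∈ Finset.range m, (fun τ : Words d => τ j) ⁻¹' {ω j} := by
    ext τ; simp [cyl]
  rw [this]
  exact isOpen_biInter_finset fun j _ => (isOpen_discrete _).preimage (continuous_apply j)

theorem injOn_cyl {d : ℕ} (m : ℕ) (ω : Words d) : Set.InjOn (shift^[m]) (cyl m ω) :=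
  fun _ ha _ hb h => eq_of_shift_iterate_eq h fun j hj => (ha j hj).trans (hb j hj).symm

theorem isOpenMap_shift_iterate {d : ℕ} (m : ℕ) : IsOpenMap (shift^[m] : Words d → Words d) := by
  intro U hU
  have : (shift^[m] : Words d → Words d) '' U = ⋃ β : Fin m → Fin d, prepend β ⁻¹' U := by
    ext τ
    simp only [Set.mem_image, Set.mem_iUnion, Set.mem_preimage]
    constructor
    · rintro ⟨ω, hω, rfl⟩
      exact ⟨fun j => ω j, by rwa [prepend_restrict]⟩
    · rintro ⟨β, hβ⟩
      exact ⟨_, hβ, shift_iterate_prepend β τ⟩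
  rw [this]
  exact isOpen_iUnion fun β => hU.preimage (continuous_prepend β)

theorem isEmbedding_of_subset_cyl {d m : ℕ} {ω : Words d} {U : Set (Words d)} (hU : IsOpen U)
    (h : U ⊆ cyl m ω) : IsEmbedding (U.domRestrict (shift^[m])) :=
  (IsOpenEmbedding.of_continuous_injective_isOpenMap
    ((continuous_shift.iterate m).comp continuous_subtype_val)
    (Set.injOn_iff_injective.1 ((injOn_cyl m ω).mono h))
    ((isOpenMap_shift_iterate m).domRestrict hU)).isEmbedding

/-- The groupoid of the one-sided shift: the triples `(ω, k, τ)` for which there are natural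
numbers `m`, `n` with `k = m - n` and `σ^m ω = σ^n τ`. -/
@[ext]
structure Gpd (d : ℕ) where
  rng : Words d
  deg : ℤ
  src : Words d
  mem : ∃ m n : ℕ, deg = (m : ℤ) - n ∧ shift^[m] rng = shift^[n] src

/-- The basic set `{(ω, m - n, τ) : ω ∈ U, τ ∈ V, σ^m ω = σ^n τ}`. -/
def basicSet {d : ℕ} (U V : Set (Words d)) (m n : ℕ) : Set (Gpd d) :=
  {x | x.rng ∈ U ∧ x.deg = (m : ℤ) - n ∧ x.src ∈ V ∧ shift^[m] x.rng = shift^[n] x.src}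

/-- The étale topology of the groupoid, generated by the sets `basicSet U V m n` where `U`, `V`
are open, `σ^m` and `σ^n` map `U` and `V` homeomorphically onto their images, and these images
are equal. -/
instance {d : ℕ} : TopologicalSpace (Gpd d) :=
  TopologicalSpace.generateFrom
    {W | ∃ (U V : Set (Words d)) (m n : ℕ), IsOpen U ∧ IsOpen V ∧
      IsEmbedding (U.domRestrict (shift^[m])) ∧ IsEmbedding (V.domRestrict (shift^[n])) ∧
      shift^[m] '' U = shift^[n] '' V ∧ W = basicSet U V m n}

/-- The pairs `(ω, τ)` with `σ^m ω = σ^n τ`. -/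
abbrev Fib (d m n : ℕ) : Type := {p : Words d × Words d // shift^[m] p.1 = shift^[n] p.2}

/-- The embedding `(ω, τ) ↦ (ω, m - n, τ)`. -/
def fibIncl {d : ℕ} (m n : ℕ) (p : Fib d m n) : Gpd d :=
  ⟨p.1.1, (m : ℤ) - n, p.1.2, m, n, rfl, p.2⟩

theorem exists_basic {d m n : ℕ} (x : Gpd d) (hk : x.deg = (m : ℤ) - n)
    (hx : shift^[m] x.rng = shift^[n] x.src) {U V : Set (Words d)} (hU : IsOpen U)
    (hV : IsOpen V) (hxU : x.rng ∈ U) (hxV : x.src ∈ V) :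
    ∃ U' ⊆ U, ∃ V' ⊆ V, IsOpen (basicSet U' V' m n) ∧ x ∈ basicSet U' V' m n := by
  set U₁ := U ∩ cyl m x.rng
  set V₁ := V ∩ cyl n x.src
  have hU₁ : IsOpen U₁ := hU.inter (isOpen_cyl _ _)
  have hV₁ : IsOpen V₁ := hV.inter (isOpen_cyl _ _)
  set W := (shift^[m] '' U₁) ∩ (shift^[n] '' V₁)
  have hW : IsOpen W := (isOpenMap_shift_iterate m _ hU₁).inter (isOpenMap_shift_iterate n _ hV₁)
  have hU₂ : IsOpen (U₁ ∩ shift^[m] ⁻¹' W) := hU₁.inter (hW.preimage (continuous_shift.iterate m))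
  have hV₂ : IsOpen (V₁ ∩ shift^[n] ⁻¹' W) := hV₁.inter (hW.preimage (continuous_shift.iterate n))
  have hxU₁ : x.rng ∈ U₁ := ⟨hxU, fun _ _ => rfl⟩
  have hxV₁ : x.src ∈ V₁ := ⟨hxV, fun _ _ => rfl⟩
  have hxW : shift^[m] x.rng ∈ W := ⟨⟨_, hxU₁, rfl⟩, ⟨_, hxV₁, hx.symm⟩⟩
  refine ⟨U₁ ∩ shift^[m] ⁻¹' W, fun _ h => h.1.1, V₁ ∩ shift^[n] ⁻¹' W, fun _ h => h.1.1, ?_,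
    ⟨hxU₁, hxW⟩, hk, ⟨hxV₁, ?_⟩, hx⟩
  · refine TopologicalSpace.isOpen_generateFrom_of_mem ⟨_, _, m, n, hU₂, hV₂,
      isEmbedding_of_subset_cyl hU₂ fun _ h => h.1.2,
      isEmbedding_of_subset_cyl hV₂ fun _ h => h.1.2, ?_, rfl⟩
    rw [Set.image_inter_preimage, Set.image_inter_preimage,
      Set.inter_eq_right.2 Set.inter_subset_left, Set.inter_eq_right.2 Set.inter_subset_right]
  · show shift^[n] x.src ∈ W
    rw [← hx]; exact hxW

/-- On `{σ^m ω = σ^n τ}`, the relation `σ^m' ω = σ^n' τ` (with `m' - n' = m - n`) is open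
and closed. -/
theorem isClopen_fib {d m n m' n' : ℕ} (h : (m' : ℤ) - n' = (m : ℤ) - n) :
    IsClopen {p : Fib d m n | shift^[m'] p.1.1 = shift^[n'] p.1.2} := by
  have : {p : Fib d m n | shift^[m'] p.1.1 = shift^[n'] p.1.2} =
      ⋂ j ∈ Finset.range (m - m'), {p : Fib d m n | p.1.1 (j + m') = p.1.2 (j + n')} := by
    ext p
    simp only [Set.mem_ofPred_eq, Set.mem_iInter, Finset.mem_range]
    constructor
    · intro hp j _
      have := congrFun hp j
      simpa [shift_iterate_apply] using this
    · intro hp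
      funext j
      rw [shift_iterate_apply, shift_iterate_apply]
      by_cases hj : j < m - m'
      · exact hp j hj
      · have := congrFun p.2 (j + m' - m)
        rw [shift_iterate_apply, shift_iterate_apply] at this
        have e1 : j + m' - m + m = j + m' := by omega
        have e2 : j + m' - m + n = j + n' := by omega
        rwa [e1, e2] at this
  rw [this]
  refine isClopen_biInter_finset fun j _ => ?_
  have hc : Continuous fun p : Fib d m n => (p.1.1 (j + m'), p.1.2 (j + n')) := by fun_prop
  exact (isClopen_discrete {q : Fin d × Fin d | q.1 = q.2}).preimage hc

theorem continuous_fibIncl {d : ℕ} (m n : ℕ) : Continuous (fibIncl (d := d) m n) := by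
  refine continuous_generateFrom_iff.2 ?_
  rintro _ ⟨U, V, m', n', hU, hV, -, -, -, rfl⟩
  by_cases h : (m' : ℤ) - n' = (m : ℤ) - n
  · have : fibIncl m n ⁻¹' basicSet U V m' n' = ((fun p : Fib d m n => p.1.1) ⁻¹' U ∩
        (fun p : Fib d m n => p.1.2) ⁻¹' V) ∩
        {p : Fib d m n | shift^[m'] p.1.1 = shift^[n'] p.1.2} := by
      ext p
      simp only [Set.mem_preimage, basicSet, fibIncl, Set.mem_ofPred_eq, Set.mem_inter_iff, h]
      tauto
    rw [this]
    exact ((hU.preimage (by fun_prop)).inter (hV.preimage (by fun_prop))).inter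
      (isClopen_fib h).isOpen
  · have : fibIncl m n ⁻¹' basicSet U V m' n' = ∅ := by
      ext p
      simp only [Set.mem_preimage, basicSet, fibIncl, Set.mem_ofPred_eq, Set.mem_empty_iff_false,
        iff_false]
      exact fun hp => h hp.2.1.symm
    rw [this]
    exact isOpen_empty

theorem fibIncl_injective {d : ℕ} (m n : ℕ) : Function.Injective (fibIncl (d := d) m n) := by
  intro p q h
  have h1 := congrArg Gpd.rng h
  have h2 := congrArg Gpd.src h
  exact Subtype.ext (Prod.ext h1 h2)

theorem isOpenEmbedding_fibIncl {d : ℕ} (m n : ℕ) : IsOpenEmbedding (fibIncl (d := d) m n) := by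
  refine .of_continuous_injective_isOpenMap (continuous_fibIncl m n) (fibIncl_injective m n) ?_
  intro O hO
  obtain ⟨O', hO', rfl⟩ := isOpen_induced_iff.1 hO
  refine isOpen_iff_forall_mem_open.2 ?_
  rintro _ ⟨p, hp, rfl⟩
  obtain ⟨U, V, hU, hV, hpU, hpV, hUV⟩ := isOpen_prod_iff.1 hO' p.1.1 p.1.2 hp
  obtain ⟨U', hU', V', hV', ho, hx⟩ :=
    exists_basic (fibIncl m n p) rfl p.2 hU hV hpU hpV
  refine ⟨_, ?_, ho, hx⟩
  rintro y ⟨hy1, hy2, hy3, hy4⟩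
  exact ⟨⟨(y.rng, y.src), hy4⟩, hUV ⟨hU' hy1, hV' hy3⟩, Gpd.ext rfl hy2.symm rfl⟩

theorem exists_fibIncl {d : ℕ} (x : Gpd d) : ∃ m n, ∃ p, fibIncl m n p = x := by
  obtain ⟨m, n, hk, h⟩ := x.mem
  exact ⟨m, n, ⟨(x.rng, x.src), h⟩, Gpd.ext rfl hk.symm rfl⟩

theorem gpd_continuous_iff {d : ℕ} {Y : Type*} [TopologicalSpace Y] {f : Gpd d → Y} :
    Continuous f ↔ ∀ m n, Continuous (f ∘ fibIncl m n) := by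
  refine ⟨fun h m n => h.comp (continuous_fibIncl m n), fun h => ?_⟩
  refine continuous_iff_continuousAt.2 fun x => ?_
  obtain ⟨m, n, p, rfl⟩ := exists_fibIncl x
  exact (isOpenEmbedding_fibIncl m n).continuousAt_iff.1 (h m n).continuousAt

instance {d : ℕ} : T2Space (Gpd d) := by
  refine T2Space.of_injective_continuous (f := fun x : Gpd d => (x.rng, x.deg, x.src)) ?_ ?_
  · intro x y h
    simp only [Prod.mk.injEq] at h
    exact Gpd.ext h.1 h.2.1 h.2.2
  · refine gpd_continuous_iff.2 fun m n => ?_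
    show Continuous fun p : Fib d m n => (p.1.1, (m : ℤ) - n, p.1.2)
    fun_prop

theorem isCompact_range_fibIncl {d : ℕ} (m n : ℕ) :
    IsCompact (Set.range (fibIncl (d := d) m n)) := by
  have : CompactSpace (Fib d m n) := by
    refine isCompact_iff_compactSpace.1 (IsClosed.isCompact ?_)
    exact isClosed_eq ((continuous_shift.iterate m).comp continuous_fst)
      ((continuous_shift.iterate n).comp continuous_snd)
  exact isCompact_range (continuous_fibIncl m n)

/-- The arrows `(ω, k, τ)` with `|k| ≤ N` and `σ^(N+k) ω = σ^N τ`. -/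
def ball (d N : ℕ) : Set (Gpd d) :=
  {x | -(N : ℤ) ≤ x.deg ∧ x.deg ≤ N ∧ shift^[(N + x.deg).toNat] x.rng = shift^[N] x.src}

theorem shift_iterate_mono {d m n : ℕ} {ω τ : Words d} (h : shift^[m] ω = shift^[n] τ) (j : ℕ) :
    shift^[m + j] ω = shift^[n + j] τ := by
  rw [add_comm m, add_comm n, Function.iterate_add_apply, Function.iterate_add_apply, h]

theorem ball_mono {d : ℕ} : Monotone (ball d) := by
  intro N M h x hx
  obtain ⟨h1, h2, h3⟩ := hx
  refine ⟨by omega, by omega, ?_⟩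
  have := shift_iterate_mono h3 (M - N)
  rwa [show (N + x.deg).toNat + (M - N) = (M + x.deg).toNat by omega,
    show N + (M - N) = M by omega] at this

theorem isCompact_ball (d N : ℕ) : IsCompact (ball d N) := by
  have : ball d N = ⋃ k ∈ Finset.Icc (-(N : ℤ)) N, Set.range (fibIncl (d := d) (N + k).toNat N) := by
    ext x
    simp only [ball, Set.mem_ofPred_eq, Set.mem_iUnion, Set.mem_range, Finset.mem_Icc, exists_prop]
    constructor
    · rintro ⟨h1, h2, h3⟩
      exact ⟨x.deg, ⟨h1, h2⟩, ⟨(x.rng, x.src), h3⟩, Gpd.ext rfl (by simp [fibIncl]; omega) rfl⟩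
    · rintro ⟨k, ⟨h1, h2⟩, p, rfl⟩
      have : (((N : ℤ) + k).toNat : ℤ) - N = k := by omega
      simp only [fibIncl, this]
      exact ⟨h1, h2, p.2⟩
  rw [this]
  exact (Finset.Icc (-(N : ℤ)) N).isCompact_biUnion fun k _ => isCompact_range_fibIncl _ _

theorem exists_ball {d : ℕ} {C : Set (Gpd d)} (hC : IsCompact C) : ∃ N, C ⊆ ball d N := by
  have hcov : C ⊆ ⋃ q : ℕ × ℕ, Set.range (fibIncl (d := d) q.1 q.2) := by
    intro x _
    obtain ⟨m, n, p, rfl⟩ := exists_fibIncl x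
    exact Set.mem_iUnion.2 ⟨(m, n), p, rfl⟩
  obtain ⟨t, ht⟩ := hC.elim_finite_subcover _
    (fun q : ℕ × ℕ => (isOpenEmbedding_fibIncl q.1 q.2).isOpen_range) hcov
  refine ⟨t.sup fun q : ℕ × ℕ => q.1 + q.2, fun x hx => ?_⟩
  obtain ⟨q, hq, p, rfl⟩ := by simpa only [Set.mem_iUnion, exists_prop] using ht hx
  refine ball_mono (Finset.le_sup (f := fun q : ℕ × ℕ => q.1 + q.2) hq) ?_
  refine ⟨by simp [fibIncl]; omega, by simp [fibIncl]; omega, ?_⟩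
  have := shift_iterate_mono p.2 q.1
  simp only [fibIncl]
  rw [show (((q.1 + q.2 : ℕ) : ℤ) + ((q.1 : ℤ) - q.2)).toNat = q.1 + q.1 by omega,
    show q.1 + q.2 = q.2 + q.1 by omega]
  exact this


theorem mem_range_fibIncl {d m n : ℕ} (x : Gpd d) :
    x ∈ Set.range (fibIncl m n) ↔ x.deg = (m : ℤ) - n ∧ shift^[m] x.rng = shift^[n] x.src := by
  constructor
  · rintro ⟨p, rfl⟩
    exact ⟨rfl, p.2⟩
  · rintro ⟨h1, h2⟩
    exact ⟨⟨(x.rng, x.src), h2⟩, Gpd.ext rfl h1.symm rfl⟩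

theorem continuous_rng {d : ℕ} : Continuous (Gpd.rng (d := d)) :=
  gpd_continuous_iff.2 fun m n => by
    show Continuous fun p : Fib d m n => p.1.1
    fun_prop

theorem continuous_graph {d : ℕ} (m n : ℕ) (h : C(Words d, ℂ)) :
    Continuous ((Set.range (fibIncl (d := d) m n)).indicator fun x => h x.rng) := by
  have : IsClopen (Set.range (fibIncl (d := d) m n)) :=
    ⟨(isCompact_range_fibIncl m n).isClosed, (isOpenEmbedding_fibIncl m n).isOpen_range⟩
  exact Continuous.indicator (by simp [this.frontier_eq]) (h.continuous.comp continuous_rng)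

/-- `C_c(G)`: the continuous compactly supported complex functions on the groupoid. -/
structure Cc (d : ℕ) where
  toFun : Gpd d → ℂ
  cont : Continuous toFun
  cpt : HasCompactSupport toFun

namespace Cc

variable {d : ℕ}

instance : CoeFun (Cc d) fun _ => Gpd d → ℂ := ⟨Cc.toFun⟩

theorem fun_ext {f g : Cc d} (h : ∀ x, f x = g x) : f = g := by
  cases f; cases g; congr 1; exact funext h

instance : Zero (Cc d) := ⟨⟨fun _ => 0, continuous_const, HasCompactSupport.zero⟩⟩

instance : Add (Cc d) := ⟨fun f g => ⟨fun x => f x + g x, f.cont.add g.cont, f.cpt.add g.cpt⟩⟩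

instance : Neg (Cc d) := ⟨fun f => ⟨fun x => -f x, f.cont.neg, f.cpt.neg⟩⟩

instance : SMul ℂ (Cc d) := ⟨fun c f => ⟨fun x => c * f x, f.cont.const_mul c, f.cpt.mul_left⟩⟩

theorem add_apply (f g : Cc d) (x : Gpd d) : (f + g) x = f x + g x := rfl
theorem zero_apply (x : Gpd d) : (0 : Cc d) x = 0 := rfl
theorem neg_apply (f : Cc d) (x : Gpd d) : (-f) x = -f x := rfl
theorem smul_apply (c : ℂ) (f : Cc d) (x : Gpd d) : (c • f) x = c * f x := rfl

instance : AddCommGroup (Cc d) where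
  add_assoc f g h := fun_ext fun x => add_assoc (f x) (g x) (h x)
  zero_add f := fun_ext fun x => zero_add (f x)
  add_zero f := fun_ext fun x => add_zero (f x)
  neg_add_cancel f := fun_ext fun x => neg_add_cancel (f x)
  add_comm f g := fun_ext fun x => add_comm (f x) (g x)
  nsmul := nsmulRec
  zsmul := zsmulRec

instance : Module ℂ (Cc d) where
  one_smul f := fun_ext fun x => one_mul (f x)
  mul_smul a b f := fun_ext fun x => mul_assoc a b (f x)
  smul_zero a := fun_ext fun _ => mul_zero a
  smul_add a f g := fun_ext fun x => mul_add a (f x) (g x)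
  add_smul a b f := fun_ext fun x => add_mul a b (f x)
  zero_smul f := fun_ext fun x => zero_mul (f x)

theorem exists_supp (f : Cc d) : ∃ N, ∀ x, f x ≠ 0 → x ∈ ball d N := by
  obtain ⟨N, hN⟩ := exists_ball f.cpt
  exact ⟨N, fun x hx => hN (subset_tsupport _ hx)⟩

/-- A function on the groupoid that is continuous on each piece `{σ^m ω = σ^n τ}` and is supported
in some `ball d N` is an element of `C_c(G)`. -/
def ofFun (f : Gpd d → ℂ) (hc : ∀ m n, Continuous (f ∘ fibIncl m n))
    (hs : ∃ N, ∀ x, f x ≠ 0 → x ∈ ball d N) : Cc d :=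
  ⟨f, gpd_continuous_iff.2 hc, by
    obtain ⟨N, hN⟩ := hs
    exact HasCompactSupport.of_support_subset_isCompact (isCompact_ball d N) hN⟩

theorem ofFun_apply (f : Gpd d → ℂ) (hc) (hs) (x : Gpd d) : ofFun f hc hs x = f x := rfl

end Cc

open Classical in
/-- Extension of a function on the groupoid by zero to all triples `(ω, k, τ)`. -/
def ext0 {d : ℕ} (f : Gpd d → ℂ) (ω : Words d) (k : ℤ) (τ : Words d) : ℂ :=
  if h : ∃ m n : ℕ, k = (m : ℤ) - n ∧ shift^[m] ω = shift^[n] τ then f ⟨ω, k, τ, h⟩ else 0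

/-- The convolution `(f * g)(ω, k, τ) = ∑ f(ω, l, ν) g(ν, k - l, τ)`, the sum being over all
`(l, ν)` for which both `(ω, l, ν)` and `(ν, k - l, τ)` belong to the groupoid. -/
def conv {d : ℕ} (f g : Gpd d → ℂ) (x : Gpd d) : ℂ :=
  ∑ᶠ p : ℤ × Words d, ext0 f x.rng p.1 p.2 * ext0 g p.2 (x.deg - p.1) x.src

/-- The involution `f*(ω, k, τ) = conj (f (τ, -k, ω))`. -/
def invol {d : ℕ} (f : Gpd d → ℂ) (x : Gpd d) : ℂ :=
  starRingEnd ℂ (ext0 f x.src (-x.deg) x.rng)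

section conv

variable {d : ℕ}

theorem ext0_self (f : Gpd d → ℂ) (x : Gpd d) : ext0 f x.rng x.deg x.src = f x := by
  unfold ext0; rw [dif_pos x.mem]

theorem ext0_of_mem (f : Gpd d → ℂ) {ω τ : Words d} {k : ℤ}
    (h : ∃ m n : ℕ, k = (m : ℤ) - n ∧ shift^[m] ω = shift^[n] τ) :
    ext0 f ω k τ = f ⟨ω, k, τ, h⟩ := dif_pos h

theorem mem_of_ext0_ne {f : Gpd d → ℂ} {ω τ : Words d} {k : ℤ} (h : ext0 f ω k τ ≠ 0) :
    ∃ m n : ℕ, k = (m : ℤ) - n ∧ shift^[m] ω = shift^[n] τ := by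
  by_contra hn
  exact h (dif_neg hn)

theorem mem_inv {ω τ : Words d} {k : ℤ}
    (h : ∃ m n : ℕ, k = (m : ℤ) - n ∧ shift^[m] ω = shift^[n] τ) :
    ∃ m n : ℕ, -k = (m : ℤ) - n ∧ shift^[m] τ = shift^[n] ω := by
  obtain ⟨m, n, hk, h⟩ := h
  exact ⟨n, m, by omega, h.symm⟩

theorem mem_comp {ω ν τ : Words d} {k l : ℤ}
    (h : ∃ m n : ℕ, k = (m : ℤ) - n ∧ shift^[m] ω = shift^[n] ν)
    (h' : ∃ m n : ℕ, l = (m : ℤ) - n ∧ shift^[m] ν = shift^[n] τ) :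
    ∃ m n : ℕ, k + l = (m : ℤ) - n ∧ shift^[m] ω = shift^[n] τ := by
  obtain ⟨m, n, hk, h⟩ := h
  obtain ⟨a, b, hl, h'⟩ := h'
  refine ⟨m + a, b + n, by omega, ?_⟩
  rw [shift_iterate_mono h a, add_comm n a, shift_iterate_mono h' n]

theorem ext0_ne_ball {f : Gpd d → ℂ} {N : ℕ} (hN : ∀ x, f x ≠ 0 → x ∈ ball d N) {ω τ : Words d}
    {k : ℤ} (h : ext0 f ω k τ ≠ 0) :
    -(N : ℤ) ≤ k ∧ k ≤ N ∧ shift^[(N + k).toNat] ω = shift^[N] τ := by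
  have hm := mem_of_ext0_ne h
  rw [ext0_of_mem f hm] at h
  exact hN _ h

theorem ext0_invol (f : Gpd d → ℂ) (ω τ : Words d) (k : ℤ) :
    ext0 (invol f) ω k τ = starRingEnd ℂ (ext0 f τ (-k) ω) := by
  by_cases h : ∃ m n : ℕ, k = (m : ℤ) - n ∧ shift^[m] ω = shift^[n] τ
  · rw [ext0_of_mem _ h]; rfl
  · have h' : ¬ ∃ m n : ℕ, -k = (m : ℤ) - n ∧ shift^[m] τ = shift^[n] ω := by
      intro h'
      have := mem_inv h'
      rw [neg_neg] at this
      exact h this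
    rw [ext0, dif_neg h, ext0, dif_neg h', map_zero]

theorem ext0_conv (f g : Gpd d → ℂ) (ω τ : Words d) (k : ℤ) :
    ext0 (conv f g) ω k τ =
      ∑ᶠ p : ℤ × Words d, ext0 f ω p.1 p.2 * ext0 g p.2 (k - p.1) τ := by
  by_cases h : ∃ m n : ℕ, k = (m : ℤ) - n ∧ shift^[m] ω = shift^[n] τ
  · rw [ext0_of_mem _ h]; rfl
  · rw [ext0, dif_neg h, eq_comm]
    refine finsum_eq_zero_of_forall_eq_zero fun p => ?_
    by_contra hne
    have := mem_comp (mem_of_ext0_ne (left_ne_zero_of_mul hne))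
      (mem_of_ext0_ne (right_ne_zero_of_mul hne))
    rw [add_sub_cancel] at this
    exact h this

open Classical in
/-- All `(l, ν)` for which `(ω, l, ν)` can lie in `ball d N`. -/
def rngFinset (N : ℕ) (ω : Words d) : Finset (ℤ × Words d) :=
  (Finset.Icc (-(N : ℤ)) N ×ˢ (Finset.univ : Finset (Fin N → Fin d))).image
    fun q : ℤ × (Fin N → Fin d) => (q.1, prepend q.2 (shift^[(N + q.1).toNat] ω))

theorem mem_rngFinset {f : Gpd d → ℂ} {N : ℕ} (hN : ∀ x, f x ≠ 0 → x ∈ ball d N) {ω : Words d}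
    {p : ℤ × Words d} (h : ext0 f ω p.1 p.2 ≠ 0) : p ∈ rngFinset N ω := by
  classical
  obtain ⟨h1, h2, h3⟩ := ext0_ne_ball hN h
  refine Finset.mem_image.2 ⟨(p.1, fun j => p.2 j), by simp [h1, h2], ?_⟩
  simp only
  rw [h3, prepend_restrict]

theorem conv_finset {f : Gpd d → ℂ} {N : ℕ} (hN : ∀ x, f x ≠ 0 → x ∈ ball d N)
    (g : ℤ × Words d → ℂ) (ω : Words d) :
    ∑ᶠ p : ℤ × Words d, ext0 f ω p.1 p.2 * g p =
      ∑ p ∈ rngFinset N ω, ext0 f ω p.1 p.2 * g p :=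
  finsum_eq_sum_of_support_subset _ fun _ hp => mem_rngFinset hN (left_ne_zero_of_mul hp)

theorem conv_explicit {f : Gpd d → ℂ} {N : ℕ} (hN : ∀ x, f x ≠ 0 → x ∈ ball d N)
    (g : ℤ × Words d → ℂ) (ω : Words d) :
    ∑ᶠ p : ℤ × Words d, ext0 f ω p.1 p.2 * g p =
      ∑ l ∈ Finset.Icc (-(N : ℤ)) N, ∑ β : Fin N → Fin d,
        ext0 f ω l (prepend β (shift^[(N + l).toNat] ω)) *
          g (l, prepend β (shift^[(N + l).toNat] ω)) := by
  classical
  rw [conv_finset hN, rngFinset, Finset.sum_image, Finset.sum_product]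
  rintro ⟨l, β⟩ _ ⟨l', β'⟩ _ h
  simp only [Prod.mk.injEq] at h
  obtain ⟨rfl, h⟩ := h
  refine Prod.ext rfl (funext fun j => ?_)
  have := congrFun h j
  simpa [prepend] using this

theorem continuous_conv (f g : Cc d) (m n : ℕ) : Continuous (conv f g ∘ fibIncl m n) := by
  obtain ⟨N, hN⟩ := f.exists_supp
  have e : conv f g ∘ fibIncl m n = fun p : Fib d m n =>
      ∑ l ∈ Finset.Icc (-(N : ℤ)) N, ∑ β : Fin N → Fin d,
        ext0 f p.1.1 l (prepend β (shift^[(N + l).toNat] p.1.1)) *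
          ext0 g (prepend β (shift^[(N + l).toNat] p.1.1)) ((m : ℤ) - n - l) p.1.2 := by
    funext p
    exact conv_explicit hN (fun q => ext0 g q.2 ((m : ℤ) - n - q.1) p.1.2) p.1.1
  rw [e]
  refine continuous_finsetSum _ fun l hl => continuous_finsetSum _ fun β _ => ?_
  rw [Finset.mem_Icc] at hl
  set a := (N + l).toNat with ha
  have hmap : Continuous fun p : Fib d m n => prepend β (shift^[a] p.1.1) :=
    (continuous_prepend β).comp ((continuous_shift.iterate a).comp (by fun_prop))
  refine Continuous.mul ?_ ?_
  · let φ : Fib d m n → Fib d a N := fun p =>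
      ⟨(p.1.1, prepend β (shift^[a] p.1.1)), (shift_iterate_prepend _ _).symm⟩
    have hφ : Continuous φ := Continuous.subtype_mk
      (Continuous.prodMk (by fun_prop) hmap) _
    have : (fun p : Fib d m n => ext0 f p.1.1 l (prepend β (shift^[a] p.1.1))) =
        fun p => f (fibIncl a N (φ p)) := by
      funext p
      have hl' : l = (a : ℤ) - N := by omega
      rw [ext0_of_mem f ⟨a, N, hl', (shift_iterate_prepend _ _).symm⟩]
      exact congrArg _ (Gpd.ext rfl hl' rfl)
    rw [this]
    exact f.cont.comp ((continuous_fibIncl a N).comp hφ)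
  · have key : ∀ p : Fib d m n,
        shift^[N + m] (prepend β (shift^[a] p.1.1)) = shift^[n + a] p.1.2 := by
      intro p
      rw [add_comm N m, Function.iterate_add_apply, shift_iterate_prepend,
        ← Function.iterate_add_apply, shift_iterate_mono p.2 a]
    let φ : Fib d m n → Fib d (N + m) (n + a) := fun p =>
      ⟨(prepend β (shift^[a] p.1.1), p.1.2), key p⟩
    have hφ : Continuous φ := Continuous.subtype_mk
      (Continuous.prodMk hmap (by fun_prop)) _
    have : (fun p : Fib d m n => ext0 g (prepend β (shift^[a] p.1.1)) ((m : ℤ) - n - l) p.1.2) =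
        fun p => g (fibIncl (N + m) (n + a) (φ p)) := by
      funext p
      have hl' : (m : ℤ) - n - l = ((N + m : ℕ) : ℤ) - ((n + a : ℕ) : ℤ) := by omega
      rw [ext0_of_mem g ⟨N + m, n + a, hl', key p⟩]
      exact congrArg _ (Gpd.ext rfl hl' rfl)
    rw [this]
    exact g.cont.comp ((continuous_fibIncl _ _).comp hφ)

theorem supp_conv (f g : Cc d) : ∃ N, ∀ x, conv f g x ≠ 0 → x ∈ ball d N := by
  obtain ⟨N₁, hN₁⟩ := f.exists_supp
  obtain ⟨N₂, hN₂⟩ := g.exists_supp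
  refine ⟨N₁ + N₂, fun x hx => ?_⟩
  obtain ⟨p, hp⟩ : ∃ p : ℤ × Words d,
      ext0 f x.rng p.1 p.2 * ext0 g p.2 (x.deg - p.1) x.src ≠ 0 := by
    by_contra hn
    push Not at hn
    exact hx (finsum_eq_zero_of_forall_eq_zero hn)
  obtain ⟨h1, h2, h3⟩ := ext0_ne_ball hN₁ (left_ne_zero_of_mul hp)
  obtain ⟨h4, h5, h6⟩ := ext0_ne_ball hN₂ (right_ne_zero_of_mul hp)
  refine ⟨by push_cast; omega, by push_cast; omega, ?_⟩
  have e1 := shift_iterate_mono h3 (N₂ + (x.deg - p.1)).toNat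
  have e2 := shift_iterate_mono h6 N₁
  rw [show (((N₁ + N₂ : ℕ) : ℤ) + x.deg).toNat =
    (N₁ + p.1).toNat + (N₂ + (x.deg - p.1)).toNat by omega, e1, add_comm, e2, add_comm]

theorem continuous_invol (f : Cc d) (m n : ℕ) : Continuous (invol f ∘ fibIncl m n) := by
  let φ : Fib d m n → Fib d n m := fun p => ⟨(p.1.2, p.1.1), p.2.symm⟩
  have hφ : Continuous φ := Continuous.subtype_mk (by fun_prop) _
  have : invol f ∘ fibIncl m n = fun p => starRingEnd ℂ (f (fibIncl n m (φ p))) := by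
    funext p
    have hl : -((m : ℤ) - n) = (n : ℤ) - m := by omega
    simp only [Function.comp, invol, fibIncl]
    rw [ext0_of_mem f ⟨n, m, hl, p.2.symm⟩]
    exact congrArg (fun z => starRingEnd ℂ (f z)) (Gpd.ext rfl hl rfl)
  rw [this]
  exact Complex.continuous_conj.comp (f.cont.comp ((continuous_fibIncl n m).comp hφ))

theorem supp_invol (f : Cc d) : ∃ N, ∀ x, invol f x ≠ 0 → x ∈ ball d N := by
  obtain ⟨N, hN⟩ := f.exists_supp
  refine ⟨N + N, fun x hx => ?_⟩
  have hx' : ext0 f x.src (-x.deg) x.rng ≠ 0 := fun h => hx (by simp [invol, h])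
  obtain ⟨h1, h2, h3⟩ := ext0_ne_ball hN hx'
  refine ⟨by push_cast; omega, by push_cast; omega, ?_⟩
  have := shift_iterate_mono h3 (N + x.deg).toNat
  rw [show (N + -x.deg).toNat + (N + x.deg).toNat = N + N by omega] at this
  rw [this]
  congr 2
  omega

end conv


namespace Cc

variable {d : ℕ}

instance : Mul (Cc d) := ⟨fun f g => ofFun (conv f g) (continuous_conv f g) (supp_conv f g)⟩

instance : Star (Cc d) := ⟨fun f => ofFun (invol f) (continuous_invol f) (supp_invol f)⟩

theorem mul_apply (f g : Cc d) (x : Gpd d) : (f * g) x = conv f g x := rfl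

theorem star_apply (f : Cc d) (x : Gpd d) : star f x = invol f x := rfl

theorem ext0_mul (f g : Cc d) (ω τ : Words d) (k : ℤ) :
    ext0 (f * g : Cc d) ω k τ =
      ∑ᶠ p : ℤ × Words d, ext0 f ω p.1 p.2 * ext0 g p.2 (k - p.1) τ := ext0_conv f g ω τ k

theorem ext0_star (f : Cc d) (ω τ : Words d) (k : ℤ) :
    ext0 (star f : Cc d) ω k τ = starRingEnd ℂ (ext0 f τ (-k) ω) := ext0_invol f ω τ k

theorem ext0_add (f g : Cc d) (ω τ : Words d) (k : ℤ) :
    ext0 (f + g : Cc d) ω k τ = ext0 f ω k τ + ext0 g ω k τ := by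
  unfold ext0; split_ifs <;> simp [add_apply]

theorem ext0_smul (c : ℂ) (f : Cc d) (ω τ : Words d) (k : ℤ) :
    ext0 (c • f : Cc d) ω k τ = c * ext0 f ω k τ := by
  unfold ext0; split_ifs <;> simp [smul_apply]

theorem ext0_zero (ω τ : Words d) (k : ℤ) : ext0 (0 : Cc d) ω k τ = 0 := by
  unfold ext0; split_ifs <;> simp [zero_apply]

theorem ext0_ext {f g : Cc d} (h : ∀ ω k τ, ext0 f ω k τ = ext0 g ω k τ) : f = g :=
  fun_ext fun x => by rw [← ext0_self f.toFun, ← ext0_self g.toFun, h]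

open Classical in
/-- The function `(ω, k, τ) ↦ [k = 0][ω = τ] h(ω)` for a continuous function `h`
on the unit space. -/
def ofUnits (h : C(Words d, ℂ)) : Cc d where
  toFun x := if x.deg = 0 ∧ x.rng = x.src then h x.rng else 0
  cont := by
    convert continuous_graph 0 0 h using 1
    funext x
    by_cases hx : x.deg = 0 ∧ x.rng = x.src
    · rw [if_pos hx, Set.indicator_of_mem ((mem_range_fibIncl x).2 (by simpa using hx))]
    · rw [if_neg hx, Set.indicator_of_notMem fun h => hx (by simpa using (mem_range_fibIncl x).1 h)]
  cpt := by
    refine HasCompactSupport.of_support_subset_isCompact (isCompact_range_fibIncl 0 0) ?_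
    intro x hx
    by_contra hn
    exact hx (if_neg fun h => hn ((mem_range_fibIncl x).2 (by simpa using h)))

instance : One (Cc d) := ⟨ofUnits 1⟩

open Classical in
theorem ext0_one (ω τ : Words d) (k : ℤ) :
    ext0 (1 : Cc d) ω k τ = if k = 0 ∧ ω = τ then 1 else 0 := by
  by_cases h : ∃ m n : ℕ, k = (m : ℤ) - n ∧ shift^[m] ω = shift^[n] τ
  · rw [ext0_of_mem _ h]
    show (if k = 0 ∧ ω = τ then (1 : ℂ) else 0) = _
    rfl
  · rw [ext0, dif_neg h, if_neg]
    rintro ⟨rfl, rfl⟩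
    exact h ⟨0, 0, by simp, rfl⟩

theorem finite_rng (f : Cc d) (ω : Words d) :
    (Function.support fun p : ℤ × Words d => ext0 f ω p.1 p.2).Finite := by
  obtain ⟨N, hN⟩ := f.exists_supp
  exact (rngFinset N ω).finite_toSet.subset fun _ hp => mem_rngFinset hN hp

theorem finite_mul (f : Cc d) (ω : Words d) (g : ℤ × Words d → ℂ) :
    (Function.support fun p : ℤ × Words d => ext0 f ω p.1 p.2 * g p).Finite :=
  (f.finite_rng ω).subset fun _ hp => left_ne_zero_of_mul hp

theorem mul_assoc' (f g h : Cc d) : f * g * h = f * (g * h) := by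
  refine ext0_ext fun ω k τ => ?_
  rw [ext0_mul, ext0_mul]
  simp only [ext0_mul]
  obtain ⟨N, hN⟩ := f.exists_supp
  have e1 : ∀ q : ℤ × Words d,
      (∑ᶠ p : ℤ × Words d, ext0 f ω p.1 p.2 * ext0 g p.2 (q.1 - p.1) q.2) *
        ext0 h q.2 (k - q.1) τ =
      ∑ p ∈ rngFinset N ω, ext0 f ω p.1 p.2 *
        (ext0 g p.2 (q.1 - p.1) q.2 * ext0 h q.2 (k - q.1) τ) := by
    intro q
    rw [conv_finset hN (fun p => ext0 g p.2 (q.1 - p.1) q.2), Finset.sum_mul]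
    exact Finset.sum_congr rfl fun p _ => by ring
  have fin : ∀ p : ℤ × Words d, (Function.support fun q : ℤ × Words d => ext0 f ω p.1 p.2 *
        (ext0 g p.2 (q.1 - p.1) q.2 * ext0 h q.2 (k - q.1) τ)).Finite := by
    intro p
    have := ((g.finite_rng p.2).image fun r : ℤ × Words d => (r.1 + p.1, r.2))
    refine this.subset fun q hq => ?_
    refine ⟨(q.1 - p.1, q.2), ?_, by simp⟩
    exact left_ne_zero_of_mul (right_ne_zero_of_mul hq)
  simp only [e1]
  rw [finsum_sum_comm _ _ fun p _ => fin p,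
    conv_finset hN (fun p => ∑ᶠ q : ℤ × Words d, ext0 g p.2 q.1 q.2 *
      ext0 h q.2 (k - p.1 - q.1) τ)]
  refine Finset.sum_congr rfl fun p _ => ?_
  have fin' : (Function.support fun q : ℤ × Words d =>
      ext0 g p.2 (q.1 - p.1) q.2 * ext0 h q.2 (k - q.1) τ).Finite := by
    have := ((g.finite_rng p.2).image fun r : ℤ × Words d => (r.1 + p.1, r.2))
    refine this.subset fun q hq => ?_
    exact ⟨(q.1 - p.1, q.2), left_ne_zero_of_mul hq, by simp⟩
  rw [← mul_finsum' _ _ fin']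
  congr 1
  refine finsum_eq_of_bijective (fun q : ℤ × Words d => (q.1 - p.1, q.2)) ?_ ?_
  · refine Function.bijective_iff_has_inverse.2 ⟨fun q => (q.1 + p.1, q.2), ?_, ?_⟩ <;>
      intro q <;> simp
  · intro q
    simp only
    rw [show k - p.1 - (q.1 - p.1) = k - q.1 by ring]

theorem star_mul' (f g : Cc d) : star (f * g) = star g * star f := by
  refine ext0_ext fun ω k τ => ?_
  rw [ext0_star, ext0_mul, ext0_mul]
  simp only [ext0_star]
  have hfin := f.finite_mul τ fun p => ext0 g p.2 (-k - p.1) ω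
  have hmap := (starRingEnd ℂ).toAddMonoidHom.map_finsum hfin
  simp only [RingHom.toAddMonoidHom_eq_coe, AddMonoidHom.coe_coe] at hmap
  rw [hmap]
  refine finsum_eq_of_bijective (fun q : ℤ × Words d => (k + q.1, q.2)) ?_ ?_
  · refine Function.bijective_iff_has_inverse.2 ⟨fun q => (q.1 - k, q.2), ?_, ?_⟩ <;>
      intro q <;> simp
  · intro q
    simp only [map_mul]
    rw [show -(k + q.1) = -k - q.1 by ring, show -(k - (k + q.1)) = q.1 by ring, mul_comm]

theorem star_star' (f : Cc d) : star (star f) = f :=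
  ext0_ext fun ω k τ => by simp [ext0_star]

theorem star_add' (f g : Cc d) : star (f + g) = star f + star g :=
  ext0_ext fun ω k τ => by simp [ext0_star, ext0_add]

theorem star_smul' (c : ℂ) (f : Cc d) : star (c • f) = star c • star f :=
  ext0_ext fun ω k τ => by simp [ext0_star, ext0_smul]

theorem add_mul' (f g h : Cc d) : (f + g) * h = f * h + g * h := by
  refine ext0_ext fun ω k τ => ?_
  simp only [ext0_add, ext0_mul, add_mul]
  exact finsum_add_distrib (f.finite_mul ω fun p => ext0 h p.2 (k - p.1) τ)
    (g.finite_mul ω fun p => ext0 h p.2 (k - p.1) τ)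

theorem mul_add' (f g h : Cc d) : f * (g + h) = f * g + f * h := by
  refine ext0_ext fun ω k τ => ?_
  simp only [ext0_add, ext0_mul, mul_add]
  exact finsum_add_distrib (f.finite_mul ω fun p => ext0 g p.2 (k - p.1) τ)
    (f.finite_mul ω fun p => ext0 h p.2 (k - p.1) τ)

theorem smul_mul' (c : ℂ) (f g : Cc d) : c • f * g = c • (f * g) := by
  refine ext0_ext fun ω k τ => ?_
  simp only [ext0_smul, ext0_mul, mul_assoc]
  exact (mul_finsum' _ _ (f.finite_mul ω fun p => ext0 g p.2 (k - p.1) τ)).symm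

theorem mul_smul' (c : ℂ) (f g : Cc d) : f * c • g = c • (f * g) := by
  refine ext0_ext fun ω k τ => ?_
  simp only [ext0_smul, ext0_mul]
  rw [mul_finsum' _ _ (f.finite_mul ω fun p => ext0 g p.2 (k - p.1) τ)]
  exact finsum_congr fun p => by ring

theorem one_mul' (f : Cc d) : 1 * f = f := by
  refine ext0_ext fun ω k τ => ?_
  simp only [ext0_mul, ext0_one]
  rw [finsum_eq_single _ ((0 : ℤ), ω)]
  · simp
  · rintro ⟨l, ν⟩ h
    rw [if_neg, zero_mul]
    rintro ⟨rfl, rfl⟩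
    exact h rfl

theorem mul_one' (f : Cc d) : f * 1 = f := by
  refine ext0_ext fun ω k τ => ?_
  simp only [ext0_mul, ext0_one]
  rw [finsum_eq_single _ (k, τ)]
  · simp
  · rintro ⟨l, ν⟩ h
    rw [if_neg, mul_zero]
    rintro ⟨h1, rfl⟩
    exact h (by rw [sub_eq_zero.1 h1])

instance : Ring (Cc d) where
  __ := (inferInstance : AddCommGroup (Cc d))
  mul_assoc := mul_assoc'
  left_distrib := mul_add'
  right_distrib := add_mul'
  one_mul := one_mul'
  mul_one := mul_one'
  zero_mul f := by
    have := add_mul' 0 0 f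
    simpa using this
  mul_zero f := by
    have := mul_add' f 0 0
    simpa using this

instance : StarRing (Cc d) where
  star_involutive := star_star'
  star_mul := star_mul'
  star_add := star_add'

instance : Algebra ℂ (Cc d) := Algebra.ofModule smul_mul' mul_smul'

instance : StarModule ℂ (Cc d) := ⟨star_smul'⟩

end Cc

open scoped ENNReal

/-- The `I`-norm `max (sup_ω ∑_{r x = ω} |f x|) (sup_ω ∑_{s x = ω} |f x|)`. -/
def iNorm {d : ℕ} (f : Cc d) : ℝ≥0∞ :=
  (⨆ ω : Words d, ∑' x : {x : Gpd d // x.rng = ω}, ‖f x‖ₑ) ⊔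
    (⨆ ω : Words d, ∑' x : {x : Gpd d // x.src = ω}, ‖f x‖ₑ)

/-- A bounded `*`-representation of `C_c(G)` on a Hilbert space: a `*`-homomorphism into the
bounded operators whose norm is dominated by the `I`-norm. -/
structure BddRep (d : ℕ) where
  H : Type
  [normed : NormedAddCommGroup H]
  [hilbert : InnerProductSpace ℂ H]
  [complete : CompleteSpace H]
  toHom : Cc d →⋆ₙₐ[ℂ] (H →L[ℂ] H)
  bounded : ∀ f, ‖toHom f‖ₑ ≤ iNorm f

attribute [instance] BddRep.normed BddRep.hilbert BddRep.complete

instance {d : ℕ} : Nonempty (BddRep d) := ⟨⟨ℂ, 0, fun f => by simp⟩⟩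

theorem iNorm_lt_top {d : ℕ} (f : Cc d) : iNorm f < ∞ := by
  classical
  have key : ∀ f : Cc d, ∃ C : ℝ≥0∞, C < ∞ ∧
      ∀ ω, ∑' p : ℤ × Words d, ‖ext0 f ω p.1 p.2‖ₑ ≤ C := by
    intro f
    obtain ⟨N, hN⟩ := f.exists_supp
    obtain ⟨C, hC⟩ := f.cpt.exists_bound_of_continuous f.cont
    have hC' : ∀ ω k τ, ‖ext0 f ω k τ‖ₑ ≤ ENNReal.ofReal C := by
      intro ω k τ
      unfold ext0
      split_ifs with h
      · rw [← ofReal_norm]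
        exact ENNReal.ofReal_le_ofReal (hC _)
      · simp
    refine ⟨((Finset.Icc (-(N : ℤ)) N ×ˢ (Finset.univ : Finset (Fin N → Fin d))).card : ℝ≥0∞) *
      ENNReal.ofReal C, ENNReal.mul_lt_top (ENNReal.natCast_lt_top _) ENNReal.ofReal_lt_top, fun ω => ?_⟩
    rw [tsum_eq_sum (s := rngFinset N ω)]
    · refine (Finset.sum_le_card_nsmul _ _ _ fun p _ => hC' _ _ _).trans ?_
      rw [nsmul_eq_mul]
      gcongr
      exact Finset.card_image_le
    · intro p hp
      rw [enorm_eq_zero]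
      by_contra hne
      exact hp (mem_rngFinset hN hne)
  refine max_lt ?_ ?_
  · obtain ⟨C, hC, h⟩ := key f
    refine lt_of_le_of_lt (iSup_le fun ω => le_trans ?_ (h ω)) hC
    have : ∀ x : {x : Gpd d // x.rng = ω}, ‖f x‖ₑ = ‖ext0 f ω x.1.deg x.1.src‖ₑ := by
      rintro ⟨x, rfl⟩; rw [ext0_self]
    simp only [this]
    refine ENNReal.tsum_comp_le_tsum_of_injective
      (f := fun x : {x : Gpd d // x.rng = ω} => (x.1.deg, x.1.src)) ?_
      (fun p : ℤ × Words d => ‖ext0 f ω p.1 p.2‖ₑ)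
    rintro ⟨x, hx⟩ ⟨y, hy⟩ hxy
    simp only [Prod.mk.injEq] at hxy
    exact Subtype.ext (Gpd.ext (hx.trans hy.symm) hxy.1 hxy.2)
  · obtain ⟨C, hC, h⟩ := key (star f)
    refine lt_of_le_of_lt (iSup_le fun ω => le_trans ?_ (h ω)) hC
    have : ∀ x : {x : Gpd d // x.src = ω},
        ‖f x‖ₑ = ‖ext0 (star f : Cc d) ω (-x.1.deg) x.1.rng‖ₑ := by
      rintro ⟨x, rfl⟩
      rw [Cc.ext0_star, neg_neg, ext0_self, ← ofReal_norm, ← ofReal_norm, RCLike.norm_conj]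
    simp only [this]
    refine ENNReal.tsum_comp_le_tsum_of_injective
      (f := fun x : {x : Gpd d // x.src = ω} => (-x.1.deg, x.1.rng)) ?_
      (fun p : ℤ × Words d => ‖ext0 (star f : Cc d) ω p.1 p.2‖ₑ)
    rintro ⟨x, hx⟩ ⟨y, hy⟩ hxy
    simp only [Prod.mk.injEq, neg_inj] at hxy
    exact Subtype.ext (Gpd.ext hxy.2 hxy.1 (hx.trans hy.symm))

namespace Cc

variable {d : ℕ}

/-- The full groupoid C*-norm: the supremum of `‖π f‖` over all bounded `*`-representations. -/
instance : Norm (Cc d) := ⟨fun f => ⨆ ρ : BddRep d, ‖ρ.toHom f‖⟩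

theorem norm_def (f : Cc d) : ‖f‖ = ⨆ ρ : BddRep d, ‖ρ.toHom f‖ := rfl

theorem bddAbove (f : Cc d) : BddAbove (Set.range fun ρ : BddRep d => ‖ρ.toHom f‖) := by
  refine ⟨(iNorm f).toReal, ?_⟩
  rintro _ ⟨ρ, rfl⟩
  simp only
  have := ENNReal.toReal_mono (iNorm_lt_top f).ne (ρ.bounded f)
  rwa [toReal_enorm] at this

theorem le_norm (f : Cc d) (ρ : BddRep d) : ‖ρ.toHom f‖ ≤ ‖f‖ := le_ciSup f.bddAbove ρ

theorem norm_le {f : Cc d} {C : ℝ} (h : ∀ ρ : BddRep d, ‖ρ.toHom f‖ ≤ C) : ‖f‖ ≤ C := ciSup_le h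

theorem norm_nonneg' (f : Cc d) : 0 ≤ ‖f‖ :=
  (norm_nonneg _).trans (f.le_norm (Classical.arbitrary _))

theorem norm_smul_le' (c : ℂ) (f : Cc d) : ‖c • f‖ ≤ ‖c‖ * ‖f‖ :=
  norm_le fun ρ => by
    rw [map_smul, norm_smul]
    exact mul_le_mul_of_nonneg_left (f.le_norm ρ) (norm_nonneg c)

theorem norm_mul_le' (f g : Cc d) : ‖f * g‖ ≤ ‖f‖ * ‖g‖ :=
  norm_le fun ρ => by
    rw [map_mul]
    exact (norm_mul_le _ _).trans
      (mul_le_mul (f.le_norm ρ) (g.le_norm ρ) (norm_nonneg _) f.norm_nonneg')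

theorem norm_star' (f : Cc d) : ‖star f‖ = ‖f‖ := by
  simp only [norm_def, map_star, norm_star]

theorem norm_mul_self_le' (f : Cc d) : ‖f‖ * ‖f‖ ≤ ‖star f * f‖ := by
  have h : ‖f‖ ≤ √‖star f * f‖ := norm_le fun ρ => by
    refine Real.le_sqrt_of_sq_le ?_
    have := (star f * f).le_norm ρ
    rwa [map_mul, map_star, CStarRing.norm_star_mul_self, ← sq] at this
  calc ‖f‖ * ‖f‖ ≤ √‖star f * f‖ * √‖star f * f‖ :=
        mul_le_mul h h f.norm_nonneg' (Real.sqrt_nonneg _)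
    _ = ‖star f * f‖ := Real.mul_self_sqrt (norm_nonneg' _)

instance : SeminormedAddCommGroup (Cc d) :=
  AddGroupSeminorm.toSeminormedAddCommGroup
    { toFun := fun f => ‖f‖
      map_zero' := by simp [norm_def]
      add_le' := fun f g => norm_le fun ρ => by
        rw [map_add]
        exact (norm_add_le _ _).trans (add_le_add (f.le_norm ρ) (g.le_norm ρ))
      neg' := fun f => by simp only [norm_def, map_neg, norm_neg] }

instance : SeminormedRing (Cc d) where
  __ := (inferInstance : SeminormedAddCommGroup (Cc d))
  __ := (inferInstance : Ring (Cc d))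
  norm_mul_le := norm_mul_le'

instance : NormedAlgebra ℂ (Cc d) where
  norm_smul_le := norm_smul_le'

end Cc

/-- The Cuntz algebra `O_d`, realized as the full groupoid C*-algebra `C*(G)`: the (Hausdorff)
completion of `C_c(G)` in the full C*-norm. -/
def CuntzAlgebra (d : ℕ) : Type := UniformSpace.Completion (Cc d)

namespace CuntzAlgebra

variable {d : ℕ}

instance : NormedRing (CuntzAlgebra d) :=
  inferInstanceAs (NormedRing (UniformSpace.Completion (Cc d)))

instance : CompleteSpace (CuntzAlgebra d) :=
  inferInstanceAs (CompleteSpace (UniformSpace.Completion (Cc d)))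

instance : NormedSpace ℂ (CuntzAlgebra d) :=
  inferInstanceAs (NormedSpace ℂ (UniformSpace.Completion (Cc d)))

/-- The canonical map `C_c(G) → C*(G)`. -/
def ofCc (f : Cc d) : CuntzAlgebra d := ((f : UniformSpace.Completion (Cc d)))

theorem dense_ofCc : DenseRange (ofCc (d := d)) := UniformSpace.Completion.denseRange_coe

theorem continuous_ofCc : Continuous (ofCc (d := d)) := UniformSpace.Completion.continuous_coe _

theorem norm_ofCc (f : Cc d) : ‖ofCc f‖ = ‖f‖ := UniformSpace.Completion.norm_coe f

theorem ofCc_mul (f g : Cc d) : ofCc (f * g) = ofCc f * ofCc g :=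
  UniformSpace.Completion.coe_mul f g

theorem ofCc_add (f g : Cc d) : ofCc (f + g) = ofCc f + ofCc g :=
  UniformSpace.Completion.coe_add f g

theorem ofCc_smul (c : ℂ) (f : Cc d) : ofCc (c • f) = c • ofCc f :=
  UniformSpace.Completion.coe_smul c f

theorem isometry_star : Isometry (star : Cc d → Cc d) :=
  Isometry.of_dist_eq fun f g => by
    rw [dist_eq_norm, dist_eq_norm, ← star_sub, Cc.norm_star']

instance : Star (CuntzAlgebra d) := ⟨UniformSpace.Completion.map (star : Cc d → Cc d)⟩

theorem ofCc_star (f : Cc d) : ofCc (star f) = star (ofCc f) :=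
  (UniformSpace.Completion.map_coe isometry_star.uniformContinuous f).symm

theorem continuous_star' : Continuous (star : CuntzAlgebra d → CuntzAlgebra d) :=
  UniformSpace.Completion.continuous_map

theorem induct {p : CuntzAlgebra d → Prop} (hp : IsClosed {x | p x}) (h : ∀ f, p (ofCc f))
    (x : CuntzAlgebra d) : p x := UniformSpace.Completion.induction_on x hp h

theorem induct₂ {p : CuntzAlgebra d → CuntzAlgebra d → Prop}
    (hp : IsClosed {x : CuntzAlgebra d × CuntzAlgebra d | p x.1 x.2})
    (h : ∀ f g, p (ofCc f) (ofCc g)) (x y : CuntzAlgebra d) : p x y :=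
  UniformSpace.Completion.induction_on₂ x y hp h

instance : StarRing (CuntzAlgebra d) where
  star_involutive x := by
    refine induct (isClosed_eq (continuous_star'.comp continuous_star') continuous_id)
      (fun f => ?_) x
    show star (star (ofCc f)) = ofCc f
    rw [← ofCc_star, ← ofCc_star, star_star]
  star_mul x y := by
    refine induct₂ (p := fun x y => star (x * y) = star y * star x)
      (isClosed_eq (continuous_star'.comp (continuous_fst.mul continuous_snd))
        ((continuous_star'.comp continuous_snd).mul (continuous_star'.comp continuous_fst)))
      (fun f g => ?_) x y
    rw [← ofCc_mul, ← ofCc_star, ← ofCc_star, ← ofCc_star, ← ofCc_mul, star_mul]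
  star_add x y := by
    refine induct₂ (p := fun x y => star (x + y) = star x + star y)
      (isClosed_eq (continuous_star'.comp (continuous_fst.add continuous_snd))
        ((continuous_star'.comp continuous_fst).add (continuous_star'.comp continuous_snd)))
      (fun f g => ?_) x y
    rw [← ofCc_add, ← ofCc_star, ← ofCc_star, ← ofCc_star, ← ofCc_add, star_add]

theorem smul_mul' (c : ℂ) (x y : CuntzAlgebra d) : c • x * y = c • (x * y) := by
  refine induct₂ (p := fun x y => c • x * y = c • (x * y))
    (isClosed_eq ((continuous_fst.const_smul c).mul continuous_snd)
      ((continuous_fst.mul continuous_snd).const_smul c)) (fun f g => ?_) x y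
  rw [← ofCc_smul, ← ofCc_mul, ← ofCc_mul, ← ofCc_smul, smul_mul_assoc]

theorem mul_smul' (c : ℂ) (x y : CuntzAlgebra d) : x * c • y = c • (x * y) := by
  refine induct₂ (p := fun x y => x * c • y = c • (x * y))
    (isClosed_eq (continuous_fst.mul (continuous_snd.const_smul c))
      ((continuous_fst.mul continuous_snd).const_smul c)) (fun f g => ?_) x y
  rw [← ofCc_smul, ← ofCc_mul, ← ofCc_mul, ← ofCc_smul, mul_smul_comm]

instance : NormedAlgebra ℂ (CuntzAlgebra d) where
  __ := Algebra.ofModule (R := ℂ) (A := CuntzAlgebra d) smul_mul' mul_smul'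
  norm_smul_le c x := norm_smul_le c x

instance : CStarAlgebra (CuntzAlgebra d) where
  norm_mul_self_le x := by
    refine induct (p := fun x => ‖x‖ * ‖x‖ ≤ ‖star x * x‖)
      (isClosed_le (by fun_prop) (continuous_norm.comp (continuous_star'.mul continuous_id)))
      (fun f => ?_) x
    rw [← ofCc_star, ← ofCc_mul, norm_ofCc, norm_ofCc]
    exact f.norm_mul_self_le'
  star_smul c x := by
    refine induct (p := fun x => star (c • x) = star c • star x)
      (isClosed_eq (continuous_star'.comp (continuous_const_smul c))
        ((continuous_const_smul (star c)).comp continuous_star')) (fun f => ?_) x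
    rw [← ofCc_smul, ← ofCc_star, ← ofCc_star, ← ofCc_smul, star_smul]

end CuntzAlgebra

open scoped NNReal ComplexOrder

section Correspondence

variable {A E : Type*} [CommCStarAlgebra A] [PartialOrder A] [StarOrderedRing A]
  [NormedAddCommGroup E] [NormedSpace ℂ E] [Module A E] [IsScalarTower ℂ A E] [CStarModule A E]

theorem norm_act_le (a : A) (ξ : E) : ‖a • ξ‖ ≤ ‖a‖ * ‖ξ‖ := by
  rw [CStarModule.norm_eq_sqrt_norm_inner_self (A := A) (a • ξ)]
  refine Real.sqrt_le_iff.2 ⟨by positivity, ?_⟩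
  rw [CStarModule.inner_op_smul_right, CStarModule.inner_op_smul_left]
  calc ‖a * (inner A ξ ξ * star a)‖ ≤ ‖a‖ * (‖inner A ξ ξ‖ * ‖star a‖) :=
        (norm_mul_le _ _).trans (mul_le_mul_of_nonneg_left (norm_mul_le _ _) (norm_nonneg a))
    _ = (‖a‖ * ‖ξ‖) ^ 2 := by
        rw [norm_star, ← CStarModule.norm_sq_eq A (x := ξ)]; ring

variable (A) in
/-- The operator `θ_{ξ,η}(ζ) = ξ⟨η, ζ⟩`. As `A` is commutative, the right action `ξ a` of `A` on
the Hilbert module `E` is written `a • ξ`. -/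
def theta (ξ η : E) : E →L[ℂ] E :=
  LinearMap.mkContinuous
    { toFun := fun ζ => (inner A η ζ : A) • ξ
      map_add' := fun x y => by rw [CStarModule.inner_add_right, add_smul]
      map_smul' := fun c x => by
        rw [CStarModule.inner_smul_right_complex, smul_assoc, RingHom.id_apply] }
    (‖η‖ * ‖ξ‖) fun ζ => by
      refine (norm_act_le _ _).trans ?_
      calc ‖(inner A η ζ : A)‖ * ‖ξ‖ ≤ (‖η‖ * ‖ζ‖) * ‖ξ‖ :=
            mul_le_mul_of_nonneg_right (CStarModule.norm_inner_le E) (norm_nonneg ξ)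
        _ = ‖η‖ * ‖ξ‖ * ‖ζ‖ := by ring

theorem theta_apply (ξ η ζ : E) : theta A ξ η ζ = (inner A η ζ : A) • ξ := rfl

variable (A E) in
/-- `K(E)`: the closed linear span of the operators `θ_{ξ,η}`. -/
def compacts : Submodule ℂ (E →L[ℂ] E) :=
  (Submodule.span ℂ (Set.range fun p : E × E => theta A p.1 p.2)).topologicalClosure

theorem theta_mem (ξ η : E) : theta A ξ η ∈ compacts A E :=
  Submodule.le_topologicalClosure _ (Submodule.subset_span ⟨(ξ, η), rfl⟩)

variable (A E) in
/-- A C*-correspondence structure on the (complete) Hilbert C*-module `E` over the commutative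
C*-algebra `A`: a `*`-homomorphism `φ` from `A` into the adjointable operators of `E`, that is, a
homomorphism into the bounded operators such that `φ (a*)` is an adjoint of `φ a`. -/
structure Correspondence [CompleteSpace E] where
  phi : A →ₙₐ[ℂ] (E →L[ℂ] E)
  adjoint : ∀ (a : A) (ξ η : E), (inner A (phi a ξ) η : A) = inner A ξ (phi (star a) η)

variable [CompleteSpace E]

/-- The ideal `J_E = φ⁻¹(K(E))`. -/
def Correspondence.ideal (X : Correspondence A E) : Set A := {a | X.phi a ∈ compacts A E}

/-- Cuntz–Pimsner covariant representations `(ι, ψ)` of a C*-correspondence in a C*-algebra `B`.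
In `covariant`, `Ψ` is the map `(ψ, ι)⁽¹⁾ : K(E) → B`, the (unique) bounded linear
map with `θ_{ξ,η} ↦ ψ(ξ) ψ(η)*`; its existence is part of the condition. -/
structure Correspondence.IsCovariantRep (X : Correspondence A E) {B : Type*}
    [NonUnitalCStarAlgebra B] (ι : A → B) (ψ : E → B) : Prop where
  starHom : ∃ f : A →⋆ₙₐ[ℂ] B, ∀ a, f a = ι a
  linear : ∃ g : E →ₗ[ℂ] B, ∀ ξ, g ξ = ψ ξ
  bimodule : ∀ (a : A) (ξ : E) (b : A), ψ (X.phi a (b • ξ)) = ι a * ψ ξ * ι b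
  inner_map : ∀ ξ η : E, star (ψ ξ) * ψ η = ι (inner A ξ η)
  covariant : ∃ Ψ : compacts A E →L[ℂ] B,
    (∀ ξ η : E, Ψ ⟨theta A ξ η, theta_mem ξ η⟩ = ψ ξ * star (ψ η)) ∧
      ∀ (c : A) (hc : c ∈ X.ideal), Ψ ⟨X.phi c, hc⟩ = ι c

end Correspondence

/-- A hyperbolic iterated function system on a space `K` which is its own attractor: finitely many
contractions whose images cover `K`. -/
structure IFS (d : ℕ) (K : Type*) [MetricSpace K] where
  map : Fin d → K → K
  contracting : ∀ i, ∃ c : ℝ≥0, ContractingWith c (map i)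
  iUnion_range : ⋃ i, Set.range (map i) = Set.univ

namespace IFS

section

variable {d : ℕ} {K : Type*} [MetricSpace K] (Γ : IFS d K)

theorem continuous_map (i : Fin d) : Continuous (Γ.map i) := by
  obtain ⟨c, hc⟩ := Γ.contracting i
  exact hc.toLipschitzWith.continuous

/-- The branched values: the points `y` with `γ_i y = γ_j y` for some `i ≠ j`. -/
def branchedValues : Set K := {y | ∃ i j, i ≠ j ∧ Γ.map i y = Γ.map j y}

/-- The finite branch condition: there are only finitely many branched values. -/
def FiniteBranch : Prop := Γ.branchedValues.Finite

/-- The open set condition: there is a dense open set `U` such that the sets `γ_i(U)` are pairwise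
disjoint and contained in `U`. -/
def OpenSetCondition : Prop :=
  ∃ U : Set K, IsOpen U ∧ Dense U ∧ (∀ i, Γ.map i '' U ⊆ U) ∧
    ∀ i j, i ≠ j → Disjoint (Γ.map i '' U) (Γ.map j '' U)

/-- The composition `γ_{ω 0} ∘ ⋯ ∘ γ_{ω n}`. -/
def comp (ω : Words d) : ℕ → K → K
  | 0 => Γ.map (ω 0)
  | n + 1 => comp ω n ∘ Γ.map (ω (n + 1))

theorem comp_succ' (ω : Words d) (n : ℕ) :
    Γ.comp ω (n + 1) = Γ.map (ω 0) ∘ Γ.comp (shift ω) n := by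
  induction n with
  | zero => rfl
  | succ n ih => rw [comp, ih]; rfl

theorem continuous_comp (n : ℕ) (x : K) : Continuous fun ω => Γ.comp ω n x := by
  have : ∀ n, ∀ x : Words d → K, Continuous x → Continuous fun ω => Γ.comp ω n (x ω) := by
    have step : ∀ n, ∀ x : Words d → K, Continuous x →
        Continuous fun ω : Words d => Γ.map (ω n) (x ω) := by
      intro n x hx
      have h2 : Continuous fun p : Fin d × K => Γ.map p.1 p.2 :=
        continuous_prod_of_discrete_left.2 Γ.continuous_map
      exact h2.comp ((continuous_apply n).prodMk hx)
    intro n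
    induction n with
    | zero => exact step 0
    | succ n ih => exact fun x hx => ih _ (step (n + 1) x hx)
  exact this n _ continuous_const

variable [CompactSpace K]

theorem exists_rate : ∃ c : ℝ, 0 ≤ c ∧ c < 1 ∧ ∃ D : ℝ, ∀ (ω : Words d) (n : ℕ) (x y : K),
    dist (Γ.comp ω n x) (Γ.comp ω n y) ≤ D * c ^ n := by
  choose c hc using Γ.contracting
  set C : ℝ≥0 := Finset.univ.sup c
  have hC : C < 1 := (Finset.sup_lt_iff one_pos).2 fun i _ => (hc i).1
  obtain ⟨D, hD⟩ := Metric.isBounded_iff.1 (isCompact_univ (X := K)).isBounded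
  have hstep : ∀ i x y, dist (Γ.map i x) (Γ.map i y) ≤ C * dist x y := fun i x y =>
    ((hc i).toLipschitzWith.dist_le_mul x y).trans
      (mul_le_mul_of_nonneg_right (NNReal.coe_le_coe.2 (Finset.le_sup (Finset.mem_univ i)))
        dist_nonneg)
  refine ⟨C, C.2, by exact_mod_cast hC, D, fun ω n => ?_⟩
  induction n generalizing ω with
  | zero => intro x y; simpa using hD (Set.mem_univ _) (Set.mem_univ _)
  | succ n ih =>
    intro x y
    rw [comp_succ']
    calc dist (Γ.map (ω 0) (Γ.comp (shift ω) n x)) (Γ.map (ω 0) (Γ.comp (shift ω) n y))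
        ≤ C * (D * (C : ℝ) ^ n) :=
          (hstep _ _ _).trans (mul_le_mul_of_nonneg_left (ih _ x y) C.2)
      _ = D * (C : ℝ) ^ (n + 1) := by ring

variable [Nonempty K]

/-- The code map `F(i₀, i₁, …) = lim_n γ_{i₀} ∘ ⋯ ∘ γ_{iₙ}(x)`; see `tendsto_codeMap` for the
existence of the limit and its independence of `x`. -/
def codeMap (ω : Words d) : K :=
  limUnder atTop fun n => Γ.comp ω n (Classical.arbitrary K)

theorem tendsto_codeMap (ω : Words d) (x : K) :
    Tendsto (fun n => Γ.comp ω n x) atTop (𝓝 (Γ.codeMap ω)) := by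
  obtain ⟨c, h0, h1, D, hD⟩ := Γ.exists_rate
  have hc : CauchySeq fun n => Γ.comp ω n (Classical.arbitrary K) :=
    cauchySeq_of_le_geometric c D h1 fun n => hD ω n _ _
  have ht : Tendsto (fun n => Γ.comp ω n (Classical.arbitrary K)) atTop (𝓝 (Γ.codeMap ω)) :=
    hc.tendsto_limUnder
  refine ht.congr_dist (squeeze_zero (fun _ => dist_nonneg) (fun n => hD ω n _ _) ?_)
  simpa using (tendsto_pow_atTop_nhds_zero_of_lt_one h0 h1).const_mul D

theorem codeMap_eq (ω : Words d) : Γ.codeMap ω = Γ.map (ω 0) (Γ.codeMap (shift ω)) := by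
  have x := Classical.arbitrary K
  refine tendsto_nhds_unique ((tendsto_add_atTop_iff_nat 1).2 (Γ.tendsto_codeMap ω x)) ?_
  simp only [comp_succ']
  exact ((Γ.continuous_map _).tendsto _).comp (Γ.tendsto_codeMap (shift ω) x)

theorem continuous_codeMap : Continuous Γ.codeMap := by
  obtain ⟨c, h0, h1, D, hD⟩ := Γ.exists_rate
  have x := Classical.arbitrary K
  have hlim : Tendsto (fun n : ℕ => D * c ^ n) atTop (𝓝 0) := by
    simpa using (tendsto_pow_atTop_nhds_zero_of_lt_one h0 h1).const_mul D
  have hd : ∀ n ω, dist (Γ.codeMap ω) (Γ.comp ω n x) ≤ D * c ^ n := by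
    intro n ω
    have hk : ∀ k ω y, ∃ z, Γ.comp ω (n + k) y = Γ.comp ω n z := by
      intro k
      induction k with
      | zero => exact fun ω y => ⟨y, rfl⟩
      | succ k ih => exact fun ω y => ih ω (Γ.map (ω (n + k + 1)) y)
    have ht := (tendsto_add_atTop_iff_nat n).2 (Γ.tendsto_codeMap ω x)
    refine le_of_tendsto (ht.dist tendsto_const_nhds) (Eventually.of_forall fun k => ?_)
    obtain ⟨z, hz⟩ := hk k ω x
    rw [add_comm, hz]
    exact hD _ _ _ _
  have hu : TendstoUniformly (fun n ω => Γ.comp ω n x) Γ.codeMap atTop := by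
    refine Metric.tendstoUniformly_iff.2 fun ε hε => ?_
    filter_upwards [hlim.eventually_lt_const hε] with n hn ω
    exact (hd n ω).trans_lt hn
  exact hu.continuous (Frequently.of_forall fun n => Γ.continuous_comp n x)

end

/-- The union `𝒢` of the cographs `{(x, y) : x = γ_i y}`. -/
def cograph {d : ℕ} {K : Type*} [MetricSpace K] (Γ : IFS d K) : Set (K × K) :=
  {p | ∃ i, p.1 = Γ.map i p.2}

theorem mem_cograph {d : ℕ} {K : Type*} [MetricSpace K] (Γ : IFS d K) (i : Fin d) (y : K) :
    (Γ.map i y, y) ∈ Γ.cograph := ⟨i, rfl⟩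

theorem isCompact_cograph {d : ℕ} {K : Type*} [MetricSpace K] [CompactSpace K] (Γ : IFS d K) :
    IsCompact Γ.cograph := by
  have : Γ.cograph = ⋃ i, Set.range fun y => (Γ.map i y, y) := by
    ext ⟨x, y⟩
    simp only [cograph, Set.mem_ofPred_eq, Set.mem_iUnion, Set.mem_range, Prod.mk.injEq]
    constructor
    · rintro ⟨i, rfl⟩
      exact ⟨i, y, rfl, rfl⟩
    · rintro ⟨i, _, rfl, rfl⟩
      exact ⟨i, rfl⟩
  rw [this]
  exact isCompact_iUnion fun i => isCompact_range ((Γ.continuous_map i).prodMk continuous_id)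

instance {d : ℕ} {K : Type*} [MetricSpace K] [CompactSpace K] (Γ : IFS d K) :
    CompactSpace Γ.cograph := isCompact_iff_compactSpace.1 Γ.isCompact_cograph

end IFS

/-- The Kajiwara–Watatani module `E = C(𝒢)`. -/
@[ext]
structure KWModule {d : ℕ} {K : Type*} [MetricSpace K] (Γ : IFS d K) where
  toCont : C(Γ.cograph, ℂ)

namespace KWModule

variable {d : ℕ} {K : Type*} [MetricSpace K] {Γ : IFS d K}

instance : CoeFun (KWModule Γ) fun _ => Γ.cograph → ℂ := ⟨fun ξ => ξ.toCont⟩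

instance : Zero (KWModule Γ) := ⟨⟨0⟩⟩
instance : Add (KWModule Γ) := ⟨fun ξ η => ⟨ξ.toCont + η.toCont⟩⟩
instance : Neg (KWModule Γ) := ⟨fun ξ => ⟨-ξ.toCont⟩⟩
instance : SMul ℂ (KWModule Γ) := ⟨fun c ξ => ⟨c • ξ.toCont⟩⟩

/-- The right action `(ξ b)(x, y) = ξ(x, y) b(y)`. -/
instance : SMul C(K, ℂ) (KWModule Γ) :=
  ⟨fun b ξ => ⟨⟨fun p => ξ p * b p.1.2, by fun_prop⟩⟩⟩

theorem fun_ext {ξ η : KWModule Γ} (h : ∀ p, ξ p = η p) : ξ = η :=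
  KWModule.ext (ContinuousMap.ext h)

theorem zero_apply (p : Γ.cograph) : (0 : KWModule Γ) p = 0 := rfl
theorem add_apply (ξ η : KWModule Γ) (p : Γ.cograph) : (ξ + η) p = ξ p + η p := rfl
theorem neg_apply (ξ : KWModule Γ) (p : Γ.cograph) : (-ξ) p = -ξ p := rfl
theorem smul_apply (c : ℂ) (ξ : KWModule Γ) (p : Γ.cograph) : (c • ξ) p = c * ξ p := rfl
theorem act_apply (b : C(K, ℂ)) (ξ : KWModule Γ) (p : Γ.cograph) :
    (b • ξ) p = ξ p * b p.1.2 := rfl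

instance : AddCommGroup (KWModule Γ) where
  add_assoc _ _ _ := fun_ext fun _ => add_assoc _ _ _
  zero_add _ := fun_ext fun _ => zero_add _
  add_zero _ := fun_ext fun _ => add_zero _
  neg_add_cancel _ := fun_ext fun _ => neg_add_cancel _
  add_comm _ _ := fun_ext fun _ => add_comm _ _
  nsmul := nsmulRec
  zsmul := zsmulRec

instance : Module ℂ (KWModule Γ) where
  one_smul _ := fun_ext fun _ => one_mul _
  mul_smul _ _ _ := fun_ext fun _ => mul_assoc _ _ _
  smul_zero _ := fun_ext fun _ => mul_zero _
  smul_add _ _ _ := fun_ext fun _ => mul_add _ _ _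
  add_smul _ _ _ := fun_ext fun _ => add_mul _ _ _
  zero_smul _ := fun_ext fun _ => zero_mul _

instance : Module C(K, ℂ) (KWModule Γ) where
  one_smul _ := fun_ext fun _ => mul_one _
  mul_smul a b ξ := fun_ext fun p => by simp only [act_apply, ContinuousMap.mul_apply]; ring
  smul_zero _ := fun_ext fun _ => zero_mul _
  smul_add _ _ _ := fun_ext fun _ => add_mul _ _ _
  add_smul _ _ _ := fun_ext fun _ => mul_add _ _ _
  zero_smul _ := fun_ext fun _ => mul_zero _

instance : IsScalarTower ℂ C(K, ℂ) (KWModule Γ) :=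
  ⟨fun c b ξ => fun_ext fun p => by
    simp only [act_apply, smul_apply, ContinuousMap.smul_apply, smul_eq_mul]; ring⟩

theorem continuous_branch (i : Fin d) :
    Continuous fun y => (⟨(Γ.map i y, y), Γ.mem_cograph i y⟩ : Γ.cograph) :=
  Continuous.subtype_mk ((Γ.continuous_map i).prodMk continuous_id) _

/-- The inner product `⟨ξ, η⟩(y) = ∑ i, conj (ξ(γ_i y, y)) η(γ_i y, y)`. -/
instance : Inner C(K, ℂ) (KWModule Γ) where
  inner ξ η :=
    { toFun := fun y => ∑ i, starRingEnd ℂ (ξ ⟨(Γ.map i y, y), Γ.mem_cograph i y⟩) *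
        η ⟨(Γ.map i y, y), Γ.mem_cograph i y⟩
      continuous_toFun := continuous_finsetSum _ fun i _ =>
        (Complex.continuous_conj.comp (ξ.toCont.continuous.comp (continuous_branch i))).mul
          (η.toCont.continuous.comp (continuous_branch i)) }

theorem inner_apply (ξ η : KWModule Γ) (y : K) :
    (inner C(K, ℂ) ξ η : C(K, ℂ)) y =
      ∑ i, starRingEnd ℂ (ξ ⟨(Γ.map i y, y), Γ.mem_cograph i y⟩) *
        η ⟨(Γ.map i y, y), Γ.mem_cograph i y⟩ := rfl

variable [CompactSpace K]

/-- The Hilbert module norm `‖ξ‖ = ‖⟨ξ, ξ⟩‖^(1/2)`. -/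
instance : Norm (KWModule Γ) := ⟨fun ξ => √‖(inner C(K, ℂ) ξ ξ : C(K, ℂ))‖⟩

theorem inner_self_apply (ξ : KWModule Γ) (y : K) :
    (inner C(K, ℂ) ξ ξ : C(K, ℂ)) y =
      ((∑ i, ‖ξ ⟨(Γ.map i y, y), Γ.mem_cograph i y⟩‖ ^ 2 : ℝ) : ℂ) := by
  rw [inner_apply, Complex.ofReal_sum]
  exact Finset.sum_congr rfl fun i _ => by
    rw [← Complex.normSq_eq_conj_mul_self, Complex.normSq_eq_norm_sq]

instance : CStarModule C(K, ℂ) (KWModule Γ) where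
  inner_add_right := by
    intro ξ η ζ
    ext y
    simp only [inner_apply, add_apply, ContinuousMap.add_apply, mul_add, Finset.sum_add_distrib]
  inner_self_nonneg := by
    intro ξ y
    show (0 : ℂ) ≤ (inner C(K, ℂ) ξ ξ : C(K, ℂ)) y
    rw [inner_self_apply]
    exact Complex.zero_le_real.2 (Finset.sum_nonneg fun i _ => by positivity)
  inner_self := by
    intro ξ
    constructor
    · intro h
      refine fun_ext ?_
      rintro ⟨⟨x, y⟩, i, hi⟩
      simp only at hi
      subst hi
      have := congrArg (fun f : C(K, ℂ) => f y) h
      simp only [inner_self_apply, ContinuousMap.zero_apply, Complex.ofReal_eq_zero] at this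
      have h2 := (Finset.sum_eq_zero_iff_of_nonneg fun i _ => by positivity).1 this i
        (Finset.mem_univ i)
      exact norm_eq_zero.1 (pow_eq_zero_iff two_ne_zero |>.1 h2)
    · rintro rfl
      ext y
      simp [inner_apply, zero_apply]
  inner_op_smul_right := by
    intro a ξ η
    ext y
    simp only [inner_apply, act_apply, ContinuousMap.mul_apply, Finset.mul_sum]
    exact Finset.sum_congr rfl fun i _ => by ring
  inner_smul_right_complex := by
    intro c ξ η
    ext y
    simp only [inner_apply, smul_apply, ContinuousMap.smul_apply, smul_eq_mul, Finset.mul_sum]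
    exact Finset.sum_congr rfl fun i _ => by ring
  star_inner ξ η := by
    ext y
    simp only [ContinuousMap.star_apply, inner_apply, star_sum, star_mul', RCLike.star_def,
      RCLike.conj_conj, mul_comm]
  norm_eq_sqrt_norm_inner_self _ := rfl

instance : NormedAddCommGroup (KWModule Γ) :=
  NormedAddCommGroup.ofCore (CStarModule.normedSpaceCore C(K, ℂ))

instance : NormedSpace ℂ (KWModule Γ) := NormedSpace.ofCore (CStarModule.normedSpaceCore C(K, ℂ))

theorem norm_apply_le (ξ : KWModule Γ) (p : Γ.cograph) : ‖ξ p‖ ≤ ‖ξ‖ := by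
  obtain ⟨⟨x, y⟩, i, hi⟩ := p
  simp only at hi
  subst hi
  refine Real.le_sqrt_of_sq_le ?_
  refine le_trans ?_ (ContinuousMap.norm_coe_le_norm _ y)
  rw [inner_self_apply, Complex.norm_of_nonneg (Finset.sum_nonneg fun i _ => by positivity)]
  exact Finset.single_le_sum (f := fun j => ‖ξ ⟨(Γ.map j y, y), Γ.mem_cograph j y⟩‖ ^ 2)
    (fun j _ => by positivity) (Finset.mem_univ i)

theorem norm_le_of_apply_le {ξ : KWModule Γ} {C : ℝ} (hC : 0 ≤ C) (h : ∀ p, ‖ξ p‖ ≤ C) :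
    ‖ξ‖ ≤ √d * C := by
  refine Real.sqrt_le_iff.2 ⟨by positivity, ?_⟩
  refine (ContinuousMap.norm_le _ (by positivity)).2 fun y => ?_
  rw [inner_self_apply, Complex.norm_of_nonneg (Finset.sum_nonneg fun i _ => by positivity),
    mul_pow, Real.sq_sqrt (Nat.cast_nonneg d)]
  refine (Finset.sum_le_card_nsmul _ _ (C ^ 2) fun i _ => ?_).trans (by simp)
  exact pow_le_pow_left₀ (norm_nonneg _) (h _) 2

instance : CompleteSpace (KWModule Γ) := by
  refine Metric.complete_of_cauchySeq_tendsto fun u hu => ?_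
  have hv : CauchySeq fun n => (u n).toCont := by
    refine Metric.cauchySeq_iff.2 fun ε hε => ?_
    obtain ⟨N, hN⟩ := Metric.cauchySeq_iff.1 hu (ε / 2) (half_pos hε)
    refine ⟨N, fun m hm n hn => lt_of_le_of_lt ?_ (half_lt_self hε)⟩
    rw [dist_eq_norm]
    refine (ContinuousMap.norm_le _ (by positivity)).2 fun p => ?_
    have h1 := norm_apply_le (u m - u n) p
    have h2 := hN m hm n hn
    rw [dist_eq_norm] at h2
    have e : (u m - u n) p = ((u m).toCont - (u n).toCont) p := by
      rw [sub_eq_add_neg, add_apply, neg_apply, ContinuousMap.sub_apply, sub_eq_add_neg]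
    rw [← e]
    exact h1.trans h2.le
  obtain ⟨v, hv⟩ := cauchySeq_tendsto_of_complete hv
  refine ⟨⟨v⟩, tendsto_iff_norm_sub_tendsto_zero.2 ?_⟩
  have hlim := (tendsto_iff_norm_sub_tendsto_zero.1 hv).const_mul √d
  rw [mul_zero] at hlim
  refine squeeze_zero (fun _ => norm_nonneg _) (fun n => ?_) hlim
  refine norm_le_of_apply_le (norm_nonneg _) fun p => ?_
  have e : (u n - ⟨v⟩ : KWModule Γ) p = ((u n).toCont - v) p := by
    rw [sub_eq_add_neg, add_apply, neg_apply, ContinuousMap.sub_apply, sub_eq_add_neg]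
  rw [e]
  exact ContinuousMap.norm_coe_le_norm _ p

/-- The left action `(φ(a) ξ)(x, y) = a(x) ξ(x, y)`. -/
def leftMul (a : C(K, ℂ)) : KWModule Γ →L[ℂ] KWModule Γ :=
  LinearMap.mkContinuous
    { toFun := fun ξ => ⟨⟨fun p => a p.1.1 * ξ p, by fun_prop⟩⟩
      map_add' := fun _ _ => fun_ext fun _ => mul_add _ _ _
      map_smul' := fun _ _ => fun_ext fun _ => mul_left_comm _ _ _ }
    (√d * ‖a‖) fun ξ => by
      rw [mul_assoc]
      refine norm_le_of_apply_le (by positivity) fun p => ?_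
      refine (norm_mul_le _ _).trans ?_
      exact mul_le_mul (ContinuousMap.norm_coe_le_norm a _) (norm_apply_le ξ p) (norm_nonneg _)
        (norm_nonneg _)

theorem leftMul_apply (a : C(K, ℂ)) (ξ : KWModule Γ) (p : Γ.cograph) :
    leftMul a ξ p = a p.1.1 * ξ p := rfl

end KWModule

namespace IFS

variable {d : ℕ} {K : Type*} [MetricSpace K] [CompactSpace K] (Γ : IFS d K)

/-- The Kajiwara–Watatani correspondence `(E, φ) = (C(𝒢), φ)` over `A = C(K)`. -/
def correspondence : Correspondence C(K, ℂ) (KWModule Γ) where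
  phi :=
    { toFun := KWModule.leftMul
      map_smul' := fun _ _ => by
        ext1 ξ
        exact KWModule.fun_ext fun _ => mul_assoc _ _ _
      map_zero' := by
        ext1 ξ
        exact KWModule.fun_ext fun _ => zero_mul _
      map_add' := fun _ _ => by
        ext1 ξ
        exact KWModule.fun_ext fun _ => add_mul _ _ _
      map_mul' := fun _ _ => by
        ext1 ξ
        exact KWModule.fun_ext fun _ => mul_assoc _ _ _ }
  adjoint a ξ η := by
    ext y
    simp only [KWModule.inner_apply]
    refine Finset.sum_congr rfl fun i _ => ?_
    show starRingEnd ℂ (a (Γ.map i y) * _) * _ = _ * (starRingEnd ℂ (a (Γ.map i y)) * _)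
    rw [map_mul]
    ring

variable [Nonempty K]

theorem codeMap_mem_cograph {ω τ : Words d} (h : shift ω = τ) :
    (Γ.codeMap ω, Γ.codeMap τ) ∈ Γ.cograph := ⟨ω 0, by rw [← h]; exact Γ.codeMap_eq ω⟩

open Classical in
/-- The function `(ω, k, τ) ↦ [k = 0][ω = τ] a(F(ω))` on the groupoid. -/
def iotaCc (a : C(K, ℂ)) : Cc d where
  toFun x := if x.deg = 0 ∧ x.rng = x.src then a (Γ.codeMap x.rng) else 0
  cont := (Cc.ofUnits (a.comp ⟨Γ.codeMap, Γ.continuous_codeMap⟩)).cont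
  cpt := (Cc.ofUnits (a.comp ⟨Γ.codeMap, Γ.continuous_codeMap⟩)).cpt

open Classical in
/-- The function `(ω, k, τ) ↦ [k = 1][σ(ω) = τ] ξ(F(ω), F(τ))` on the groupoid. -/
def psiCc (ξ : KWModule Γ) : Cc d where
  toFun x :=
    if h : x.deg = 1 ∧ shift x.rng = x.src then
      ξ ⟨(Γ.codeMap x.rng, Γ.codeMap x.src), Γ.codeMap_mem_cograph h.2⟩
    else 0
  cont := by
    have hc : Continuous fun ω : Words d =>
        (⟨(Γ.codeMap ω, Γ.codeMap (shift ω)), Γ.codeMap_mem_cograph rfl⟩ : Γ.cograph) :=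
      Continuous.subtype_mk
        (Γ.continuous_codeMap.prodMk (Γ.continuous_codeMap.comp continuous_shift)) _
    convert continuous_graph 1 0 ⟨_, ξ.toCont.continuous.comp hc⟩ using 1
    funext x
    by_cases hx : x.deg = 1 ∧ shift x.rng = x.src
    · rw [dif_pos hx, Set.indicator_of_mem ((mem_range_fibIncl x).2 (by simpa using hx))]
      simp only [ContinuousMap.coe_mk, Function.comp, hx.2]
    · rw [dif_neg hx,
        Set.indicator_of_notMem fun h => hx (by simpa using (mem_range_fibIncl x).1 h)]
  cpt := by
    refine HasCompactSupport.of_support_subset_isCompact (isCompact_range_fibIncl 1 0) ?_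
    intro x hx
    by_contra hn
    exact hx (dif_neg fun h => hn ((mem_range_fibIncl x).2 (by simpa using h)))

/-- The map `ι : C(K) → O_d`, `ι(a)(ω, k, τ) = [k = 0][ω = τ] a(F(ω))`. -/
def iota (a : C(K, ℂ)) : CuntzAlgebra d := CuntzAlgebra.ofCc (Γ.iotaCc a)

/-- The map `ψ : E → O_d`, `ψ(ξ)(ω, k, τ) = [k = 1][σ(ω) = τ] ξ(F(ω), F(τ))`. -/
def psi (ξ : KWModule Γ) : CuntzAlgebra d := CuntzAlgebra.ofCc (Γ.psiCc ξ)

end IFS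

end KW

end

open scoped ComplexOrder

noncomputable section

namespace KW

open Topology Filter
open scoped NNReal ComplexOrder InnerProductSpace

/-! ### Functions on the unit space and the Cuntz isometries in `Cc d` -/

namespace Cc

variable {d : ℕ}

/-! Let S_i be the indicator function of {(ω, 1, σω) : ω 0 = i}. These elements satisfy S_i* S_j =
δ_ij. Write ξ_i(y) = ξ(γ_i y, y). Since F(ω) = γ_{ω 0}(F(σω)), everything can be expressed through
the S_i: ψ(ξ) = ∑ S_i ι(ξ_i) (`psi_eq_sum`) and ι(a) = ∑ S_i ι(a ∘ γ_i) S_i* (`iota_eq_sum`). The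
second formula gives ι(a) S_i = S_i ι(a ∘ γ_i) (`iota_mul_gen`). Linearity, the bimodule identity
and the inner product identity are then short computations with coordinates.

For covariance, ξ ↦ (ξ_i(y))_i embeds E isometrically in the continuous functions K → ℂ^d with the
supremum norm. The operator θ_{ξ,η} becomes the field of rank one matrices with entries ξ_i
conj(η_j). The map M ↦ ∑ S_i ι(M_ij) S_j* is a *-homomorphism `fieldHom` from C(K, M_d) to O_d,
hence a contraction, and it sends the field of θ_{ξ,η} to ψ(ξ)ψ(η)*.

It remains to attach a field to each compact operator without increasing the norm. At a branched
value y the vectors (ξ_i(y))_i may fill only a proper subspace E_y of ℂ^d, so an operator T on E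
does not determine a matrix at y. Demanding that M(y) vanish on the orthogonal complement of E_y
removes the ambiguity and gives ‖M‖ ≤ ‖T‖ (`norm_field_le`). The pairs (M, T) therefore form a
closed space on which (M, T) ↦ T is isometric. Its range is closed and contains every θ_{ξ,η}, so it
contains K(E) (`compacts_le`). Following T ↦ M by `fieldHom` gives (ψ, ι)⁽¹⁾.

Finally let φ(c) be compact with field M. At an unbranched y one has E_y = ℂ^d, which forces M(y) =
diag(c(γ_i y)). Either hypothesis on Γ makes the unbranched points dense
(`dense_compl_branchedValues`), so by continuity M is this diagonal field everywhere. Its image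
under `fieldHom` is ∑ S_i ι(c ∘ γ_i) S_i* = ι(c). -/

theorem ext0_sum {ι : Type*} (s : Finset ι) (f : ι → Cc d) (ω τ : Words d) (k : ℤ) :
    ext0 (∑ i ∈ s, f i : Cc d) ω k τ = ∑ i ∈ s, ext0 (f i) ω k τ := by
  classical
  induction s using Finset.induction_on with
  | empty => simp [ext0_zero]
  | insert i s hi ih => rw [Finset.sum_insert hi, Finset.sum_insert hi, ext0_add, ih]

open Classical in
theorem ext0_ofUnits (h : C(Words d, ℂ)) (ω τ : Words d) (k : ℤ) :
    ext0 (ofUnits h) ω k τ = if k = 0 ∧ ω = τ then h ω else 0 := by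
  by_cases hm : ∃ m n : ℕ, k = (m : ℤ) - n ∧ shift^[m] ω = shift^[n] τ
  · rw [ext0_of_mem _ hm]
    rfl
  · rw [ext0, dif_neg hm, if_neg]
    rintro ⟨rfl, rfl⟩
    exact hm ⟨0, 0, by simp, rfl⟩

theorem ext0_ofUnits_mul (h : C(Words d, ℂ)) (f : Cc d) (ω τ : Words d) (k : ℤ) :
    ext0 (ofUnits h * f) ω k τ = h ω * ext0 f ω k τ := by
  simp only [ext0_mul, ext0_ofUnits]
  rw [finsum_eq_single _ ((0 : ℤ), ω)]
  · simp
  · rintro ⟨l, ν⟩ hne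
    rw [if_neg, zero_mul]
    rintro ⟨rfl, rfl⟩
    exact hne rfl

/-- The extension of functions on the unit space by zero, as a `*`-homomorphism. -/
def ofUnitsHom (d : ℕ) : C(Words d, ℂ) →⋆ₙₐ[ℂ] Cc d where
  toFun := ofUnits
  map_smul' c h := ext0_ext fun ω k τ => by
    simp [ext0_smul, ext0_ofUnits]
  map_zero' := ext0_ext fun ω k τ => by simp [ext0_zero, ext0_ofUnits]
  map_add' g h := ext0_ext fun ω k τ => by
    rw [ext0_add, ext0_ofUnits, ext0_ofUnits, ext0_ofUnits]
    split_ifs <;> simp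
  map_mul' g h := ext0_ext fun ω k τ => by
    rw [ext0_ofUnits_mul, ext0_ofUnits, ext0_ofUnits]
    split_ifs <;> simp
  map_star' h := ext0_ext fun ω k τ => by
    rw [ext0_star, ext0_ofUnits, ext0_ofUnits]
    by_cases hk : k = 0 ∧ ω = τ
    · obtain ⟨rfl, rfl⟩ := hk
      simp
    · rw [if_neg hk, if_neg fun h' => hk ⟨by omega, h'.2.symm⟩, map_zero]

open Classical in
/-- The `i`-th canonical isometry: the indicator function of
`{(ω, 1, σ ω) : ω 0 = i}`. -/
def gen (i : Fin d) : Cc d where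
  toFun x := if x.deg = 1 ∧ shift x.rng = x.src ∧ x.rng 0 = i then 1 else 0
  cont := by
    -- The range of `fibIncl 1 0` is the clopen set {(ω, 1, σω)}, and the first letter of ω is
    -- locally constant.
    convert continuous_graph 1 0 (⟨fun ω : Words d => if ω 0 = i then 1 else 0,
      (continuous_of_discreteTopology (f := fun j : Fin d => if j = i then (1 : ℂ) else 0)).comp
        (continuous_apply 0)⟩ : C(Words d, ℂ)) using 1
    funext x
    simp only [Set.indicator, mem_range_fibIncl, Function.iterate_one, Function.iterate_zero,
      id, Nat.cast_one, Nat.cast_zero, sub_zero, ContinuousMap.coe_mk]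
    split_ifs <;> tauto
  cpt := by
    refine HasCompactSupport.of_support_subset_isCompact (isCompact_range_fibIncl 1 0) ?_
    intro x hx
    by_contra hn
    exact hx (if_neg fun h => hn ((mem_range_fibIncl x).2 (by simpa using ⟨h.1, h.2.1⟩)))

open Classical in
theorem ext0_gen (i : Fin d) (ω τ : Words d) (k : ℤ) :
    ext0 (gen i) ω k τ = if k = 1 ∧ shift ω = τ ∧ ω 0 = i then 1 else 0 := by
  by_cases hm : ∃ m n : ℕ, k = (m : ℤ) - n ∧ shift^[m] ω = shift^[n] τ
  · rw [ext0_of_mem _ hm]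
    rfl
  · rw [ext0, dif_neg hm, if_neg]
    rintro ⟨rfl, rfl, -⟩
    exact hm ⟨1, 0, by simp, rfl⟩

theorem ext0_gen_mul (i : Fin d) (f : Cc d) (ω τ : Words d) (k : ℤ) :
    ext0 (gen i * f) ω k τ = if ω 0 = i then ext0 f (shift ω) (k - 1) τ else 0 := by
  simp only [ext0_mul, ext0_gen]
  -- From ω, the support of the generator contains at most the one arrow (ω, 1, σω).
  rw [finsum_eq_single _ ((1 : ℤ), shift ω)]
  · simp
  · rintro ⟨l, ν⟩ hne
    rw [if_neg, zero_mul]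
    rintro ⟨rfl, rfl, -⟩
    exact hne rfl

theorem ext0_mul_star_gen (i : Fin d) (f : Cc d) (ω τ : Words d) (k : ℤ) :
    ext0 (f * star (gen i)) ω k τ = if τ 0 = i then ext0 f ω (k + 1) (shift τ) else 0 := by
  -- Taking adjoints turns right multiplication by S_i* into left multiplication by S_i.
  rw [← star_star (f * star (gen i)), ext0_star, star_mul, star_star, ext0_gen_mul]
  split_ifs
  · rw [ext0_star, RCLike.conj_conj]
    congr 1
    ring
  · exact map_zero _

theorem shift_prepend (i : Fin d) (ω : Words d) : shift (prepend (fun _ : Fin 1 => i) ω) = ω :=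
  shift_iterate_prepend (fun _ : Fin 1 => i) ω

theorem prepend_shift (ω : Words d) : prepend (fun _ : Fin 1 => ω 0) (shift ω) = ω := by
  have h := prepend_restrict 1 ω
  rw [Function.iterate_one] at h
  convert h using 3 with j
  rw [Nat.lt_one_iff.1 j.2]

theorem ext0_star_gen_mul (i : Fin d) (f : Cc d) (ω τ : Words d) (k : ℤ) :
    ext0 (star (gen i) * f) ω k τ = ext0 f (prepend (fun _ : Fin 1 => i) ω) (k + 1) τ := by
  simp only [ext0_mul, ext0_star, ext0_gen]
  -- The only arrow from ω in the support of S_i* is the inverse of (iω, 1, ω), where iω is ω with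
  -- the letter i in front.
  rw [finsum_eq_single _ ((-1 : ℤ), prepend (fun _ : Fin 1 => i) ω)]
  · have h0 : prepend (fun _ : Fin 1 => i) ω 0 = i := by simp [prepend]
    simp [shift_prepend, h0]
  · rintro ⟨l, ν⟩ hne
    rw [if_neg, map_zero, zero_mul]
    rintro ⟨h1, rfl, rfl⟩
    exact hne (Prod.ext (by simp only; omega) (prepend_shift ν).symm)

theorem star_gen_mul_gen (i j : Fin d) : star (gen i) * gen j = if i = j then 1 else 0 := by
  classical
  refine ext0_ext fun ω k τ => ?_
  have h0 : prepend (fun _ : Fin 1 => i) ω 0 = i := by simp [prepend]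
  rw [ext0_star_gen_mul, ext0_gen, shift_prepend, h0]
  by_cases hij : i = j
  · simp [hij, ext0_one]
  · simp [hij, ext0_zero]

end Cc

/-- The canonical map `C_c(G) → C*(G)` as a `*`-homomorphism. -/
def CuntzAlgebra.ofCcHom (d : ℕ) : Cc d →⋆ₙₐ[ℂ] CuntzAlgebra d where
  toFun := ofCc
  map_smul' := ofCc_smul
  map_zero' := UniformSpace.Completion.coe_zero
  map_add' := ofCc_add
  map_mul' := ofCc_mul
  map_star' := ofCc_star

theorem CuntzAlgebra.ofCc_one {d : ℕ} : ofCc (1 : Cc d) = 1 := UniformSpace.Completion.coe_one _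

/-! ### The isometries in the completion -/

namespace CuntzAlgebra

variable {d : ℕ}

/-- The canonical isometries generating the Cuntz algebra. -/
def gen (i : Fin d) : CuntzAlgebra d := ofCc (Cc.gen i)

theorem star_gen_mul_gen (i j : Fin d) : star (gen i) * gen j = if i = j then 1 else 0 := by
  rw [gen, gen, ← ofCc_star, ← ofCc_mul, Cc.star_gen_mul_gen]
  split_ifs
  · exact ofCc_one
  · exact map_zero (ofCcHom d)

end CuntzAlgebra

/-! ### The maps ι and ψ in terms of the isometries -/

namespace IFS

variable {d : ℕ} {K : Type*} [MetricSpace K] [CompactSpace K] [Nonempty K] (Γ : IFS d K)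

/-- The map `ι`, as a `*`-homomorphism. -/
def iotaHom : C(K, ℂ) →⋆ₙₐ[ℂ] CuntzAlgebra d :=
  (CuntzAlgebra.ofCcHom d).comp ((Cc.ofUnitsHom d).comp
    (ContinuousMap.compStarAlgHom' ℂ ℂ
      (⟨Γ.codeMap, Γ.continuous_codeMap⟩ : C(Words d, K))).toNonUnitalStarAlgHom)

theorem iotaHom_eq_ofCc (a : C(K, ℂ)) :
    Γ.iotaHom a = CuntzAlgebra.ofCc (Cc.ofUnits (a.comp ⟨Γ.codeMap, Γ.continuous_codeMap⟩)) := rfl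

theorem iotaHom_apply (a : C(K, ℂ)) : Γ.iotaHom a = Γ.iota a := rfl

/-- The `i`-th component `y ↦ ξ (γ_i y, y)` of an element of the correspondence. -/
def coord (i : Fin d) (ξ : KWModule Γ) : C(K, ℂ) :=
  ξ.toCont.comp ⟨_, KWModule.continuous_branch i⟩

/-- The composition with the `i`-th contraction. -/
def pull (i : Fin d) (a : C(K, ℂ)) : C(K, ℂ) := a.comp ⟨Γ.map i, Γ.continuous_map i⟩

open Classical in
-- Because F(ω) = γ_{ω 0}(F(σω)), the point (F(ω), F(σω)) lies on the branch numbered by the first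
-- letter of ω, so ξ is read there through one coordinate function.
theorem ext0_psiCc (ξ : KWModule Γ) (ω τ : Words d) (k : ℤ) :
    ext0 (Γ.psiCc ξ) ω k τ =
      if k = 1 ∧ shift ω = τ then Γ.coord (ω 0) ξ (Γ.codeMap τ) else 0 := by
  by_cases hm : ∃ m n : ℕ, k = (m : ℤ) - n ∧ shift^[m] ω = shift^[n] τ
  · rw [ext0_of_mem _ hm]
    simp only [psiCc]
    split_ifs with h
    · simp only [coord, ContinuousMap.comp_apply, ContinuousMap.coe_mk]
      congr 1
      refine Subtype.ext (Prod.ext ?_ rfl)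
      simp only
      rw [← h.2]
      exact Γ.codeMap_eq ω
    · rfl
  · rw [ext0, dif_neg hm, if_neg]
    rintro ⟨rfl, rfl⟩
    exact hm ⟨1, 0, by simp, rfl⟩

/-- The arrows (ω, 1, σω) are sorted by their first letter: S_i selects those with ω 0 = i, where
ψ(ξ) depends only on F(σω). -/
theorem psi_eq_sum (ξ : KWModule Γ) :
    Γ.psi ξ = ∑ i, CuntzAlgebra.gen i * Γ.iota (Γ.coord i ξ) := by
  have h : Γ.psiCc ξ = ∑ i, Cc.gen i * Cc.ofUnits ((Γ.coord i ξ).comp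
      ⟨Γ.codeMap, Γ.continuous_codeMap⟩) := by
    classical
    refine Cc.ext0_ext fun ω k τ => ?_
    rw [Cc.ext0_sum, ext0_psiCc]
    simp only [Cc.ext0_gen_mul, Cc.ext0_ofUnits, Finset.sum_ite_eq, Finset.mem_univ, if_true,
      sub_eq_zero]
    split_ifs with hk
    · rw [← hk.2]
      rfl
    · rfl
  rw [psi, h]
  refine (map_sum (CuntzAlgebra.ofCcHom d) _ _).trans (Finset.sum_congr rfl fun i _ => ?_)
  exact CuntzAlgebra.ofCc_mul _ _

/-- The unit space is the disjoint union of the cylinders {ω 0 = i}, and on the i-th one a(F(ω)) =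
(a ∘ γ_i)(F(σω)). This is the only place where the self-similarity of a function on K is transported
to O_d. -/
theorem iota_eq_sum (a : C(K, ℂ)) :
    Γ.iota a = ∑ i, CuntzAlgebra.gen i * Γ.iota (Γ.pull i a) * star (CuntzAlgebra.gen i) := by
  have h : Cc.ofUnits (a.comp ⟨Γ.codeMap, Γ.continuous_codeMap⟩) =
      ∑ i, Cc.gen i * Cc.ofUnits ((Γ.pull i a).comp ⟨Γ.codeMap, Γ.continuous_codeMap⟩) *
        star (Cc.gen i) := by
    classical
    refine Cc.ext0_ext fun ω k τ => ?_
    rw [Cc.ext0_sum]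
    simp only [Cc.ext0_mul_star_gen, Cc.ext0_gen_mul, Cc.ext0_ofUnits, Finset.sum_ite_eq,
      Finset.mem_univ, if_true, add_sub_cancel_right]
    by_cases hk : k = 0 ∧ ω = τ
    · obtain ⟨rfl, rfl⟩ := hk
      simp only [and_self, if_true, ContinuousMap.comp_apply, ContinuousMap.coe_mk, pull]
      rw [← Γ.codeMap_eq ω]
    · rw [if_neg hk]
      split_ifs with h1 h2
      -- Off the unit space the right side vanishes too: words with the same first letter and the
      -- same shift are equal.
      · refine absurd ⟨h2.1, eq_of_shift_iterate_eq (m := 1) h2.2 fun j hj => ?_⟩ hk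
        rw [Nat.lt_one_iff.1 hj, h1]
      · rfl
      · rfl
  rw [← iotaHom_apply, iotaHom_eq_ofCc, h]
  refine (map_sum (CuntzAlgebra.ofCcHom d) _ _).trans (Finset.sum_congr rfl fun i _ => ?_)
  rw [← iotaHom_apply, iotaHom_eq_ofCc, CuntzAlgebra.gen, ← CuntzAlgebra.ofCc_star,
    ← CuntzAlgebra.ofCc_mul, ← CuntzAlgebra.ofCc_mul]
  rfl

end IFS

/-- The bounded operators on `ℂ^d` with its Euclidean norm. -/
abbrev MatOp (d : ℕ) : Type :=
  EuclideanSpace ℂ (Fin d) →L[ℂ] EuclideanSpace ℂ (Fin d)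

/-! ### Matrix fields over K and their image in the Cuntz algebra -/

namespace IFS

variable {d : ℕ} {K : Type*} [MetricSpace K] [CompactSpace K] [Nonempty K] (Γ : IFS d K)

/-- The matrix entries of a continuous field of operators on `ℂ^d`. -/
def entry (i j : Fin d) (M : C(K, MatOp d)) : C(K, ℂ) :=
  ⟨fun y => M y (EuclideanSpace.single j 1) i, by fun_prop⟩

theorem entry_apply (i j : Fin d) (M : C(K, MatOp d)) (y : K) :
    entry i j M y = M y (EuclideanSpace.single j 1) i := rfl

theorem entry_mul (i k : Fin d) (M N : C(K, MatOp d)) :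
    entry i k (M * N) = ∑ j, entry i j M * entry j k N := by
  ext y
  rw [ContinuousMap.sum_apply]
  simp only [ContinuousMap.mul_apply, entry_apply]
  change M y (N y (EuclideanSpace.single k 1)) i = _
  -- Expanding N(y)e_k in the standard basis produces the sum over the middle index.
  have h := (EuclideanSpace.basisFun (Fin d) ℂ).sum_repr (N y (EuclideanSpace.single k 1))
  conv_lhs => rw [← h]
  simp only [map_sum, map_smul, EuclideanSpace.basisFun_repr, EuclideanSpace.basisFun_apply,
    WithLp.ofLp_sum, Finset.sum_apply, PiLp.smul_apply, smul_eq_mul, mul_comm]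

theorem entry_star (i j : Fin d) (M : C(K, MatOp d)) : entry i j (star M) = star (entry j i M) := by
  ext y
  simp only [ContinuousMap.star_apply, entry_apply, ContinuousLinearMap.star_eq_adjoint]
  -- The (i, j) entry is ⟨e_i, M e_j⟩, so the adjoint can be moved across the inner product.
  have h1 := EuclideanSpace.inner_single_left (𝕜 := ℂ) i (1 : ℂ)
    (ContinuousLinearMap.adjoint (M y) (EuclideanSpace.single j 1))
  have h2 := EuclideanSpace.inner_single_right (𝕜 := ℂ) j (1 : ℂ)
    (M y (EuclideanSpace.single i 1))
  rw [ContinuousLinearMap.adjoint_inner_right] at h1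
  rw [map_one, one_mul] at h1
  rw [one_mul] at h2
  rw [← h1, h2]
  rfl

/-- The relation S_j* S_k = δ_jk makes the elements S_i a S_j* multiply like matrices with the
single entry a at (i, j). It is what makes `fieldHom` multiplicative. -/
theorem gen_mul_sandwich (i j k l : Fin d) (a b : CuntzAlgebra d) :
    (CuntzAlgebra.gen i * a * star (CuntzAlgebra.gen j)) *
      (CuntzAlgebra.gen k * b * star (CuntzAlgebra.gen l)) =
      if j = k then CuntzAlgebra.gen i * (a * b) * star (CuntzAlgebra.gen l) else 0 := by
  have h : (CuntzAlgebra.gen i * a * star (CuntzAlgebra.gen j)) *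
      (CuntzAlgebra.gen k * b * star (CuntzAlgebra.gen l)) =
      CuntzAlgebra.gen i * a * (star (CuntzAlgebra.gen j) * CuntzAlgebra.gen k) *
        (b * star (CuntzAlgebra.gen l)) := by
    simp only [mul_assoc]
  rw [h, CuntzAlgebra.star_gen_mul_gen]
  split_ifs
  · simp only [mul_assoc, one_mul]
  · simp only [mul_zero, zero_mul]

/-- The `*`-homomorphism `M ↦ ∑ i j, S_i ι(M_ij) S_j*` from the continuous fields of operators
on `ℂ^d` to the Cuntz algebra. -/
def fieldHom : C(K, MatOp d) →⋆ₙₐ[ℂ] CuntzAlgebra d where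
  toFun M := ∑ i, ∑ j, CuntzAlgebra.gen i * Γ.iotaHom (entry i j M) * star (CuntzAlgebra.gen j)
  map_smul' c M := by
    have h : ∀ i j, entry i j (c • M) = c • entry i j M := fun i j => rfl
    simp only [h, map_smul, Finset.smul_sum, mul_smul_comm, smul_mul_assoc, MonoidHom.id_apply]
  map_zero' := by
    have h : ∀ i j, entry i j (0 : C(K, MatOp d)) = 0 := fun i j => rfl
    simp [h]
  map_add' M N := by
    have h : ∀ i j, entry i j (M + N) = entry i j M + entry i j N := fun i j => rfl
    simp only [h, map_add, mul_add, add_mul, Finset.sum_add_distrib]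
  map_mul' M N := by
    rw [Finset.sum_mul]
    refine Finset.sum_congr rfl fun i _ => ?_
    rw [Finset.sum_mul]
    simp only [entry_mul, map_sum, map_mul, Finset.sum_mul, Finset.mul_sum, gen_mul_sandwich]
    rw [Finset.sum_comm]
    refine Finset.sum_congr rfl fun j _ => ?_
    rw [Finset.sum_comm]
    exact Finset.sum_congr rfl fun l _ => by
      rw [Finset.sum_ite_eq, if_pos (Finset.mem_univ j)]
  map_star' M := by
    rw [star_sum, Finset.sum_comm]
    refine Finset.sum_congr rfl fun i _ => ?_
    rw [star_sum]
    refine Finset.sum_congr rfl fun j _ => ?_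
    rw [entry_star, map_star, star_mul, star_mul, star_star, mul_assoc]

theorem fieldHom_apply (M : C(K, MatOp d)) :
    Γ.fieldHom M = ∑ i, ∑ j,
      CuntzAlgebra.gen i * Γ.iotaHom (entry i j M) * star (CuntzAlgebra.gen j) := rfl

end IFS

/-- The fibre map `ξ ↦ (ξ (γ_i y, y))_i` at `y`. -/
def KWModule.fibre {d : ℕ} {K : Type*} [MetricSpace K] {Γ : IFS d K} (ξ : KWModule Γ) (y : K) :
    EuclideanSpace ℂ (Fin d) :=
  WithLp.toLp 2 fun i => ξ ⟨(Γ.map i y, y), Γ.mem_cograph i y⟩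

/-! ### The fibres of the module in ℂ^d -/

namespace KWModule

variable {d : ℕ} {K : Type*} [MetricSpace K] [CompactSpace K] {Γ : IFS d K}

theorem fibre_apply (ξ : KWModule Γ) (y : K) (i : Fin d) :
    ξ.fibre y i = ξ ⟨(Γ.map i y, y), Γ.mem_cograph i y⟩ := rfl

theorem continuous_fibre (ξ : KWModule Γ) : Continuous ξ.fibre :=
  (PiLp.continuous_toLp 2 _).comp
    (continuous_pi fun i => ξ.toCont.continuous.comp (continuous_branch i))

theorem inner_fibre (ξ η : KWModule Γ) (y : K) :
    ⟪ξ.fibre y, η.fibre y⟫_ℂ = (inner C(K, ℂ) ξ η : C(K, ℂ)) y := by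
  rw [inner_apply, PiLp.inner_apply]
  exact Finset.sum_congr rfl fun i _ => mul_comm _ _

theorem norm_fibre_sq (ξ : KWModule Γ) (y : K) :
    ((‖ξ.fibre y‖ ^ 2 : ℝ) : ℂ) = (inner C(K, ℂ) ξ ξ : C(K, ℂ)) y := by
  rw [← inner_fibre, inner_self_eq_norm_sq_to_K]
  norm_cast

theorem norm_fibre_le (ξ : KWModule Γ) (y : K) : ‖ξ.fibre y‖ ≤ ‖ξ‖ := by
  refine Real.le_sqrt_of_sq_le ?_
  refine le_trans ?_ (ContinuousMap.norm_coe_le_norm _ y)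
  rw [← norm_fibre_sq, Complex.norm_of_nonneg (by positivity)]

/-- Together with `norm_fibre_le` this says that the module norm is the supremum of the Euclidean
norms of the fibres, so norm estimates can be made pointwise. -/
theorem norm_le_of_fibre_le {ξ : KWModule Γ} {C : ℝ} (hC : 0 ≤ C) (h : ∀ y, ‖ξ.fibre y‖ ≤ C) :
    ‖ξ‖ ≤ C := by
  refine Real.sqrt_le_iff.2 ⟨hC, (ContinuousMap.norm_le _ (by positivity)).2 fun y => ?_⟩
  rw [← norm_fibre_sq, Complex.norm_of_nonneg (by positivity)]
  exact pow_le_pow_left₀ (norm_nonneg _) (h y) 2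

theorem fibre_act (b : C(K, ℂ)) (ξ : KWModule Γ) (y : K) :
    (b • ξ : KWModule Γ).fibre y = b y • ξ.fibre y := by
  ext i
  exact mul_comm _ _

variable (Γ) in
/-- The fibre map as a bounded linear map. -/
def fibreL (y : K) : KWModule Γ →L[ℂ] EuclideanSpace ℂ (Fin d) :=
  LinearMap.mkContinuous
    { toFun := fun ξ => ξ.fibre y
      map_add' := fun _ _ => rfl
      map_smul' := fun _ _ => rfl } 1 fun ξ => by
    rw [one_mul]
    exact ξ.norm_fibre_le y

variable (Γ) in
/-- The fibre of the correspondence at `y`, as a subspace of `ℂ^d`. -/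
def fibreSpace (y : K) : Submodule ℂ (EuclideanSpace ℂ (Fin d)) :=
  LinearMap.range (fibreL Γ y : KWModule Γ →ₗ[ℂ] EuclideanSpace ℂ (Fin d))

theorem fibre_mem (ξ : KWModule Γ) (y : K) : ξ.fibre y ∈ fibreSpace Γ y := ⟨ξ, rfl⟩

/-- At an unbranched y the points γ_i y are distinct, so a continuous function on the cograph can
take independent values at the points (γ_i y, y). -/
theorem fibreSpace_eq_top {y : K} (hy : y ∉ Γ.branchedValues) : fibreSpace Γ y = ⊤ := by
  classical
  have key : ∀ j, EuclideanSpace.single j (1 : ℂ) ∈ fibreSpace Γ y := by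
    intro j
    -- The product of distances to the other branch points vanishes at γ_k y for k ≠ j and not at
    -- γ_j y, so its fibre at y is a nonzero multiple of e_j.
    let ζ : KWModule Γ := ⟨⟨fun p => ((∏ i ∈ Finset.univ.erase j, dist p.1.1 (Γ.map i y) : ℝ) : ℂ),
      by fun_prop⟩⟩
    set c : ℂ := ((∏ i ∈ Finset.univ.erase j, dist (Γ.map j y) (Γ.map i y) : ℝ) : ℂ) with hc
    have hc0 : c ≠ 0 := by
      rw [hc, Complex.ofReal_ne_zero, Finset.prod_ne_zero_iff]
      intro i hi h
      exact hy ⟨j, i, (Finset.ne_of_mem_erase hi).symm, dist_eq_zero.1 h⟩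
    have hζ : ζ.fibre y = c • EuclideanSpace.single j (1 : ℂ) := by
      ext k
      rw [fibre_apply]
      by_cases hk : k = j
      · subst hk
        simp [ζ, hc]
      · have : ∏ i ∈ Finset.univ.erase j, dist (Γ.map k y) (Γ.map i y) = 0 :=
          Finset.prod_eq_zero (Finset.mem_erase.2 ⟨hk, Finset.mem_univ k⟩) (dist_self _)
        simp only [ζ, ContinuousMap.coe_mk, this]
        simp [hk]
    have := (fibreSpace Γ y).smul_mem c⁻¹ (ζ.fibre_mem y)
    rwa [hζ, smul_smul, inv_mul_cancel₀ hc0, one_smul] at this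
  refine eq_top_iff.2 fun v _ => ?_
  rw [← (EuclideanSpace.basisFun (Fin d) ℂ).sum_repr v]
  refine Submodule.sum_mem _ fun j _ => Submodule.smul_mem _ _ ?_
  rw [EuclideanSpace.basisFun_apply]
  exact key j

/-! ### Operators acting fibrewise, and the matrix field of a compact operator -/

variable (Γ) in
/-- The pairs `(M, T)` such that the operator `T` on the correspondence acts in the fibre at `y`
as `M y`, and `M y` vanishes on the orthogonal complement of that fibre. -/
def fieldGraph : Submodule ℂ (C(K, MatOp d) × (KWModule Γ →L[ℂ] KWModule Γ)) where
  carrier := {p | (∀ y ζ, (p.2 ζ).fibre y = p.1 y (ζ.fibre y)) ∧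
    ∀ y, ∀ v ∈ (fibreSpace Γ y)ᗮ, p.1 y v = 0}
  add_mem' := by
    rintro ⟨M, T⟩ ⟨N, S⟩ ⟨h1, h2⟩ ⟨h3, h4⟩
    refine ⟨fun y ζ => ?_, fun y v hv => ?_⟩
    · exact congrArg₂ (· + ·) (h1 y ζ) (h3 y ζ)
    · exact (congrArg₂ (· + ·) (h2 y v hv) (h4 y v hv)).trans (add_zero _)
  zero_mem' := ⟨fun _ _ => rfl, fun _ _ _ => rfl⟩
  smul_mem' := by
    rintro c ⟨M, T⟩ ⟨h1, h2⟩
    refine ⟨fun y ζ => ?_, fun y v hv => ?_⟩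
    · exact congrArg (c • ·) (h1 y ζ)
    · exact (congrArg (c • ·) (h2 y v hv)).trans (smul_zero _)

/-- For fixed y, ζ and v, both defining conditions are equations between continuous functions of (M,
T). -/
theorem isClosed_fieldGraph : IsClosed (fieldGraph Γ : Set (C(K, MatOp d) × (KWModule Γ →L[ℂ] KWModule Γ))) := by
  have h : (fieldGraph Γ : Set (C(K, MatOp d) × (KWModule Γ →L[ℂ] KWModule Γ))) =
      (⋂ (y : K) (ζ : KWModule Γ), {p | fibreL Γ y (p.2 ζ) = p.1 y (ζ.fibre y)}) ∩
      ⋂ (y : K) (v ∈ (fibreSpace Γ y)ᗮ), {p | p.1 y v = 0} := by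
    ext p
    simp only [Set.mem_inter_iff, Set.mem_iInter]
    rfl
  rw [h]
  refine IsClosed.inter ?_ ?_
  · exact isClosed_iInter fun y => isClosed_iInter fun ζ => isClosed_eq (by fun_prop) (by fun_prop)
  · exact isClosed_iInter fun y => isClosed_iInter fun v => isClosed_iInter fun _ =>
      isClosed_eq (by fun_prop) (by fun_prop)

/-- The bound ‖Tζ‖ ≤ ‖T‖‖ζ‖ involves the supremum over all fibres. Rescaling ζ by a function on K
makes every fibre have norm at most one, which localizes the bound at y. -/
theorem norm_field_apply_le {M : C(K, MatOp d)} {T : KWModule Γ →L[ℂ] KWModule Γ}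
    (h : (M, T) ∈ fieldGraph Γ) (ζ : KWModule Γ) (y : K) :
    ‖M y (ζ.fibre y)‖ ≤ ‖T‖ * ‖ζ.fibre y‖ := by
  have key : ∀ ε : ℝ, 0 < ε → ‖M y (ζ.fibre y)‖ ≤ ‖T‖ * (ε + ‖ζ.fibre y‖) := by
    intro ε hε
    have hpos : ∀ z, 0 < ε + ‖ζ.fibre z‖ := fun z => by positivity
    -- Adding ε keeps the normalizing factor continuous where the fibre of ζ vanishes; ε tends to 0
    -- at the end.
    let b : C(K, ℂ) := ⟨fun z => ((ε + ‖ζ.fibre z‖ : ℝ) : ℂ)⁻¹,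
      (Complex.continuous_ofReal.comp (continuous_const.add ζ.continuous_fibre.norm)).inv₀
        fun z => Complex.ofReal_ne_zero.2 (hpos z).ne'⟩
    have hb : ∀ z, ‖b z‖ = (ε + ‖ζ.fibre z‖)⁻¹ := fun z => by
      simp only [b, ContinuousMap.coe_mk, norm_inv, Complex.norm_of_nonneg (hpos z).le]
    have h1 : ‖b • ζ‖ ≤ 1 := norm_le_of_fibre_le zero_le_one fun z => by
      rw [fibre_act, norm_smul, hb, inv_mul_le_one₀ (hpos z)]
      linarith
    have h2 : ‖M y ((b • ζ : KWModule Γ).fibre y)‖ ≤ ‖T‖ := by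
      rw [← h.1]
      exact (norm_fibre_le _ y).trans (T.unit_le_opNorm _ h1)
    rw [fibre_act, map_smul, norm_smul, hb, inv_mul_le_iff₀ (hpos y)] at h2
    linarith
  have hlim : Tendsto (fun ε : ℝ => ‖T‖ * (ε + ‖ζ.fibre y‖)) (𝓝[>] 0)
      (𝓝 (‖T‖ * (0 + ‖ζ.fibre y‖))) :=
    ((by fun_prop : Continuous fun ε : ℝ => ‖T‖ * (ε + ‖ζ.fibre y‖)).tendsto 0).mono_left
      nhdsWithin_le_nhds
  rw [zero_add] at hlim
  exact ge_of_tendsto hlim (eventually_mem_nhdsWithin.mono key)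

/-- On the fibre space the estimate is `norm_field_apply_le`. On its orthogonal complement M(y) is
zero, and by Pythagoras dropping that component of v only shortens it. -/
theorem norm_field_le {M : C(K, MatOp d)} {T : KWModule Γ →L[ℂ] KWModule Γ}
    (h : (M, T) ∈ fieldGraph Γ) : ‖M‖ ≤ ‖T‖ := by
  refine (ContinuousMap.norm_le _ (norm_nonneg _)).2 fun y =>
    ContinuousLinearMap.opNorm_le_bound _ (norm_nonneg _) fun v => ?_
  obtain ⟨w, ⟨ζ, rfl⟩, z, hz, rfl⟩ := (fibreSpace Γ y).exists_add_mem_mem_orthogonal v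
  have hM : M y z = 0 := h.2 y z hz
  change ‖M y (ζ.fibre y + z)‖ ≤ ‖T‖ * ‖ζ.fibre y + z‖
  rw [map_add, hM, add_zero]
  refine (norm_field_apply_le h ζ y).trans (mul_le_mul_of_nonneg_left ?_ (norm_nonneg _))
  have h0 : ⟪ζ.fibre y, z⟫_ℂ = 0 := hz _ (ζ.fibre_mem y)
  have := norm_add_sq_eq_norm_sq_add_norm_sq_of_inner_eq_zero _ _ h0
  refine le_of_sq_le_sq ?_ (norm_nonneg _)
  nlinarith [norm_nonneg z]

variable (Γ) in
/-- The second projection on `fieldGraph`. -/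
def graphSnd : fieldGraph Γ →ₗ[ℂ] (KWModule Γ →L[ℂ] KWModule Γ) :=
  LinearMap.snd ℂ _ _ ∘ₗ (fieldGraph Γ).subtype

theorem isometry_graphSnd : Isometry (graphSnd Γ) :=
  let e : fieldGraph Γ →ₗᵢ[ℂ] (KWModule Γ →L[ℂ] KWModule Γ) :=
    -- The norm of (M, T) in the product is the maximum of the two norms, which is ‖T‖.
    ⟨graphSnd Γ, fun p => (max_eq_right (norm_field_le p.2)).symm⟩
  e.isometry

/-- The field of rank one operators belonging to `θ_{ξ,η}`. -/
def thetaField (ξ η : KWModule Γ) : C(K, MatOp d) :=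
  ⟨fun y => ContinuousLinearMap.smulRightL ℂ _ _ (innerSL ℂ (η.fibre y)) (ξ.fibre y),
    ((ContinuousLinearMap.smulRightL ℂ _ _).continuous.comp
      ((innerSL ℂ).continuous.comp η.continuous_fibre)).clm_apply ξ.continuous_fibre⟩

/-- The rank one matrix v ↦ ⟨η(y), v⟩ ξ(y) kills the complement of the fibre space because η(y)
belongs to that space. -/
theorem thetaField_mem (ξ η : KWModule Γ) :
    (thetaField ξ η, theta C(K, ℂ) ξ η) ∈ fieldGraph Γ := by
  refine ⟨fun y ζ => ?_, fun y v hv => ?_⟩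
  · change _ = ⟪η.fibre y, ζ.fibre y⟫_ℂ • ξ.fibre y
    rw [theta_apply, fibre_act, inner_fibre]
  · change ⟪η.fibre y, v⟫_ℂ • ξ.fibre y = 0
    rw [hv _ (η.fibre_mem y), zero_smul]

/-- The isometric image of a complete space is closed, so it suffices that the range contains every
θ_{ξ,η}. -/
theorem compacts_le : compacts C(K, ℂ) (KWModule Γ) ≤ LinearMap.range (graphSnd Γ) := by
  have : CompleteSpace (fieldGraph Γ) := isClosed_fieldGraph.completeSpace_coe
  refine Submodule.topologicalClosure_minimal _ (Submodule.span_le.2 ?_) ?_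
  · rintro _ ⟨⟨ξ, η⟩, rfl⟩
    exact ⟨⟨_, thetaField_mem ξ η⟩, rfl⟩
  · rw [LinearMap.coe_range]
    exact isometry_graphSnd.antilipschitz.isClosed_range isometry_graphSnd.uniformContinuous

/-- The field of operators on `ℂ^d` that belongs to a compact operator. -/
def field : compacts C(K, ℂ) (KWModule Γ) →ₗ[ℂ] C(K, MatOp d) :=
  LinearMap.fst ℂ _ _ ∘ₗ (fieldGraph Γ).subtype ∘ₗ
    (LinearEquiv.ofInjective (graphSnd Γ) isometry_graphSnd.injective).symm.toLinearMap ∘ₗ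
      Submodule.inclusion compacts_le

/-- An isometry is injective, so T determines its field, and any M found to satisfy the two
conditions is the right one. -/
theorem field_eq {M : C(K, MatOp d)} {T : KWModule Γ →L[ℂ] KWModule Γ}
    (h : (M, T) ∈ fieldGraph Γ) (hT : T ∈ compacts C(K, ℂ) (KWModule Γ)) : field ⟨T, hT⟩ = M := by
  have e : (LinearEquiv.ofInjective (graphSnd Γ) isometry_graphSnd.injective).symm
      ⟨T, compacts_le hT⟩ = ⟨(M, T), h⟩ := (LinearEquiv.symm_apply_eq _).2 rfl
  exact congrArg (fun p : fieldGraph Γ => p.1.1) e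

theorem exists_field {T : KWModule Γ →L[ℂ] KWModule Γ}
    (hT : T ∈ compacts C(K, ℂ) (KWModule Γ)) : ∃ M : C(K, MatOp d), (M, T) ∈ fieldGraph Γ := by
  obtain ⟨⟨⟨M, S⟩, h⟩, rfl⟩ := compacts_le hT
  exact ⟨M, h⟩

theorem norm_field_apply_compact_le (T : compacts C(K, ℂ) (KWModule Γ)) : ‖field T‖ ≤ ‖T‖ := by
  obtain ⟨T, hT⟩ := T
  obtain ⟨M, h⟩ := exists_field hT
  rw [field_eq h hT]
  exact norm_field_le h

end KWModule

/-! ### Density of the unbranched points and the map (ψ, ι)⁽¹⁾ -/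

namespace IFS

variable {d : ℕ} {K : Type*} [MetricSpace K] [CompactSpace K] (Γ : IFS d K)

theorem disjoint_branchedValues {U : Set K}
    (hU : ∀ i j, i ≠ j → Disjoint (Γ.map i '' U) (Γ.map j '' U)) :
    U ⊆ Γ.branchedValuesᶜ := by
  rintro y hy ⟨i, j, hij, h⟩
  exact Set.disjoint_left.1 (hU i j hij) ⟨y, hy, rfl⟩ ⟨y, hy, h.symm⟩

theorem dense_compl_branchedValues
    (hΓ : (Γ.FiniteBranch ∧ ∀ y ∈ Γ.branchedValues, ¬ IsOpen ({y} : Set K)) ∨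
      Γ.OpenSetCondition) : Dense Γ.branchedValuesᶜ := by
  rcases hΓ with ⟨hf, hi⟩ | ⟨U, -, hd, -, hU⟩
  · have h : Γ.branchedValuesᶜ = ⋂ y ∈ Γ.branchedValues, ({y} : Set K)ᶜ := by
      ext z
      simp only [Set.mem_compl_iff, Set.mem_iInter, Set.mem_singleton_iff]
      exact ⟨fun hz y hy e => hz (e ▸ hy), fun hz h => hz z h rfl⟩
    rw [h]
    -- The complement of a point is open, and it is dense exactly when the point is not isolated; a
    -- countable intersection of such sets is dense by Baire.
    refine dense_biInter_of_isOpen (fun _ _ => isOpen_compl_singleton) hf.countable fun y hy => ?_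
    exact dense_compl_singleton_iff_not_open.2 (hi y hy)
  · exact hd.mono (Γ.disjoint_branchedValues hU)

theorem entry_thetaField (ξ η : KWModule Γ) (i j : Fin d) :
    entry i j (KWModule.thetaField ξ η) = Γ.coord i ξ * star (Γ.coord j η) := by
  ext y
  change ⟪η.fibre y, EuclideanSpace.single j 1⟫_ℂ * ξ.fibre y i = _
  rw [EuclideanSpace.inner_single_right, one_mul, mul_comm]
  rfl

variable [Nonempty K]

/-- At an unbranched y each e_j is the fibre of some ζ, so M(y)e_j is the fibre of φ(c)ζ, namely
c(γ_j y)e_j. Both sides are continuous in y, and the unbranched points are dense, so the equality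
holds at the branched values as well. -/
theorem entry_of_mem_fieldGraph (hd : Dense Γ.branchedValuesᶜ) {c : C(K, ℂ)} {M : C(K, MatOp d)}
    (h : (M, Γ.correspondence.phi c) ∈ KWModule.fieldGraph Γ) (i j : Fin d) :
    entry i j M = if i = j then Γ.pull i c else 0 := by
  refine ContinuousMap.coe_injective (Continuous.ext_on hd (map_continuous _) (map_continuous _)
    fun y hy => ?_)
  obtain ⟨ζ, hζ⟩ : EuclideanSpace.single j (1 : ℂ) ∈ KWModule.fibreSpace Γ y := by
    rw [KWModule.fibreSpace_eq_top hy]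
    trivial
  change ζ.fibre y = _ at hζ
  rw [entry_apply, ← hζ, ← h.1 y ζ]
  change c (Γ.map i y) * ζ.fibre y i = _
  rw [hζ]
  by_cases hij : i = j
  · subst hij
    simp [pull]
  · simp [hij]

/-- In ∑ S_j ι(a ∘ γ_j) S_j* S_i only the term j = i survives. -/
theorem iota_mul_gen (a : C(K, ℂ)) (i : Fin d) :
    Γ.iota a * CuntzAlgebra.gen i = CuntzAlgebra.gen i * Γ.iota (Γ.pull i a) := by
  rw [iota_eq_sum, Finset.sum_mul]
  simp [mul_assoc, CuntzAlgebra.star_gen_mul_gen]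

theorem fieldHom_thetaField (ξ η : KWModule Γ) :
    Γ.fieldHom (KWModule.thetaField ξ η) = Γ.psi ξ * star (Γ.psi η) := by
  rw [fieldHom_apply, psi_eq_sum, psi_eq_sum, star_sum, Finset.sum_mul]
  refine Finset.sum_congr rfl fun i _ => ?_
  rw [Finset.mul_sum]
  refine Finset.sum_congr rfl fun j _ => ?_
  rw [entry_thetaField, map_mul, map_star, star_mul, iotaHom_apply, iotaHom_apply]
  simp only [mul_assoc]

theorem fieldHom_eq_iota (hd : Dense Γ.branchedValuesᶜ) {c : C(K, ℂ)} {M : C(K, MatOp d)}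
    (h : (M, Γ.correspondence.phi c) ∈ KWModule.fieldGraph Γ) : Γ.fieldHom M = Γ.iota c := by
  rw [fieldHom_apply, iota_eq_sum]
  refine Finset.sum_congr rfl fun i _ => ?_
  rw [Finset.sum_eq_single i]
  · rw [Γ.entry_of_mem_fieldGraph hd h, if_pos rfl, iotaHom_apply]
  · intro j _ hj
    rw [Γ.entry_of_mem_fieldGraph hd h, if_neg hj.symm, map_zero, mul_zero, zero_mul]
  · exact fun hi => absurd (Finset.mem_univ i) hi

/-- The map `fieldHom` as a linear map. -/
def fieldLinear : C(K, MatOp d) →ₗ[ℂ] CuntzAlgebra d where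
  toFun := Γ.fieldHom
  map_add' M N := map_add Γ.fieldHom M N
  map_smul' c M := by
    rw [RingHom.id_apply]
    exact Γ.fieldHom.map_smul' c M

/-- The linear map `(ψ, ι)⁽¹⁾` on the compact operators. -/
def compactsLinear : compacts C(K, ℂ) (KWModule Γ) →ₗ[ℂ] CuntzAlgebra d :=
  Γ.fieldLinear ∘ₗ KWModule.field

theorem norm_compactsLinear_le (T : compacts C(K, ℂ) (KWModule Γ)) :
    ‖Γ.compactsLinear T‖ ≤ 1 * ‖T‖ := by
  rw [one_mul]
  -- A *-homomorphism between C*-algebras is contractive, and so is T ↦ M.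
  exact (NonUnitalStarAlgHom.norm_apply_le Γ.fieldHom (KWModule.field T)).trans
    (KWModule.norm_field_apply_compact_le T)

/-- The bounded linear map `(ψ, ι)⁽¹⁾` on the compact operators. -/
def compactsMap : compacts C(K, ℂ) (KWModule Γ) →L[ℂ] CuntzAlgebra d :=
  ⟨Γ.compactsLinear, AddMonoidHomClass.continuous_of_bound Γ.compactsLinear 1
    Γ.norm_compactsLinear_le⟩

theorem compactsMap_apply {M : C(K, MatOp d)} {T : KWModule Γ →L[ℂ] KWModule Γ}
    (h : (M, T) ∈ KWModule.fieldGraph Γ) (hT : T ∈ compacts C(K, ℂ) (KWModule Γ)) :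
    Γ.compactsMap ⟨T, hT⟩ = Γ.fieldHom M :=
  congrArg Γ.fieldHom (KWModule.field_eq h hT)

end IFS

end KW

end

/-! ### The covariant representation -/

open scoped ComplexOrder
theorem mainTheorem3 {d : ℕ} {K : Type*} [MetricSpace K] [CompactSpace K] [Nonempty K]
    (Γ : KW.IFS d K)
    (hΓ : (Γ.FiniteBranch ∧ ∀ y ∈ Γ.branchedValues, ¬ IsOpen ({y} : Set K)) ∨
      Γ.OpenSetCondition) :
    Γ.correspondence.IsCovariantRep Γ.iota Γ.psi where
  starHom := ⟨Γ.iotaHom, Γ.iotaHom_apply⟩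
  linear := by
    refine ⟨{ toFun := Γ.psi, map_add' := fun ξ η => ?_, map_smul' := fun c ξ => ?_ },
      fun _ => rfl⟩
    · have h : ∀ i, Γ.coord i (ξ + η) = Γ.coord i ξ + Γ.coord i η := fun _ => rfl
      simp only [KW.IFS.psi_eq_sum, h, ← KW.IFS.iotaHom_apply, map_add, mul_add,
        Finset.sum_add_distrib]
    · have h : ∀ i, Γ.coord i (c • ξ) = c • Γ.coord i ξ := fun _ => rfl
      simp only [KW.IFS.psi_eq_sum, h, ← KW.IFS.iotaHom_apply, map_smul, mul_smul_comm,
        Finset.smul_sum, RingHom.id_apply]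
  bimodule a ξ b := by
    have h : ∀ i, Γ.coord i (Γ.correspondence.phi a (b • ξ)) =
        Γ.pull i a * (Γ.coord i ξ * b) := fun _ => rfl
    simp only [KW.IFS.psi_eq_sum, h, Finset.mul_sum, Finset.sum_mul]
    refine Finset.sum_congr rfl fun i _ => ?_
    -- Moving ι(a) past S_i replaces a by a ∘ γ_i, which is how φ(a) acts on the i-th coordinate.
    rw [← mul_assoc (Γ.iota a), KW.IFS.iota_mul_gen]
    simp only [← KW.IFS.iotaHom_apply, map_mul, mul_assoc]
  inner_map ξ η := by
    have h : (inner C(K, ℂ) ξ η : C(K, ℂ)) = ∑ i, star (Γ.coord i ξ) * Γ.coord i η := by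
      ext y
      rw [ContinuousMap.sum_apply]
      rfl
    rw [KW.IFS.psi_eq_sum, KW.IFS.psi_eq_sum, star_sum, Finset.sum_mul, h]
    simp only [← KW.IFS.iotaHom_apply, map_sum, map_mul, map_star, star_mul, Finset.mul_sum]
    refine Finset.sum_congr rfl fun i _ => ?_
    -- Orthogonality of the isometries removes all cross terms ι(ξ_i)* S_i* S_j ι(η_j) with i ≠ j.
    rw [Finset.sum_eq_single i]
    · rw [mul_assoc, ← mul_assoc (star (KW.CuntzAlgebra.gen i)),
        KW.CuntzAlgebra.star_gen_mul_gen, if_pos rfl, one_mul]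
    · intro j _ hj
      rw [mul_assoc, ← mul_assoc (star (KW.CuntzAlgebra.gen i)),
        KW.CuntzAlgebra.star_gen_mul_gen, if_neg hj.symm, zero_mul, mul_zero]
    · exact fun hi => absurd (Finset.mem_univ i) hi
  covariant := by
    refine ⟨Γ.compactsMap, fun ξ η => ?_, fun c hc => ?_⟩
    · rw [Γ.compactsMap_apply (KW.KWModule.thetaField_mem ξ η), KW.IFS.fieldHom_thetaField]
    · obtain ⟨M, h⟩ := KW.KWModule.exists_field hc
      exact (Γ.compactsMap_apply h hc).trans (Γ.fieldHom_eq_iota (Γ.dense_compl_branchedValues hΓ) h)
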